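/- For $\delta>0$ let $\mathbb L_\delta=\delta\mathbb Z\times\mathbb R\subset\mathbb C$. A primal domain of mesh size $\delta$ is the bounded open region of the plane enclosed by a closed self-avoiding path with vertices on $\mathbb L_\delta$, made of alternately horizontal and vertical segments. A scalar (real or complex) function $f$ on the vertices $\Omega_\delta\cap\mathbb L_\delta$ of a primal domain $\Omega_\delta$ is semi-discrete harmonic if it is twice differentiable along the vertical lines and $$\frac{f(p+\delta)+f(p-\delta)-2f(p)}{\delta^2}+\partial_{yy}f(p)=0$$ for every $p\in\operatorname{Int}^2\Omega_\delta$, that is, for every $p\in\mathbb L_\delta$ such that $p,\ p\pm\frac{\delta}{2},\ p\pm\delta$ all lie in $\Omega_\delta$. Let $\Omega\subset\mathbb C$ be open, bounded and simply connected, and let $\delta_0>0$. For $0<\delta<\delta_0$ let $\Omega_\delta\subset\Omega$ be a primal domain of mesh size $\delta$, such that $\Omega_\delta\to\Omega$ in the Carathéodory sense as $\delta\to0$, i.e. every compact subset of $\Omega$ is contained in $\Omega_\delta$ for all sufficiently small $\delta$. Let $h_\delta$ be a semi-discrete harmonic function on $\Omega_\delta$ for every $0<\delta<\delta_0$. **Theorem.**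 Suppose that one of the following conditions holds. 1. For every compact $K\subset\Omega$ there is $M=M(K)$ such that $|h_\delta(p)|\le M$ for all $0<\delta<\delta_0$ and all $p\in K\cap\Omega_\delta\cap\mathbb L_\delta$. 2. For every compact $K\subset\Omega$ there is $M=M(K)>0$ such that for all $0<\delta<\delta_0$ $$\delta\sum_{k\in\mathbb Z}\int_{\{y\in\mathbb R\,:\,\delta k+iy\in K\cap\Omega_\delta\}}|h_\delta(\delta k+iy)|^2\,dy\le M.$$ Then the family $(h_\delta)$ is precompact as $\delta\to0$ for uniform convergence on compact subsets of $\Omega$: for every sequence $\delta_n\in(0,\delta_0)$ with $\delta_n\to0$ there are a subsequence $(\delta_{n_j})$ and a continuous function $H$ on $\Omega$ such that, for every compact $K\subset\Omega$, $$\sup_{p\in K\cap\Omega_{\delta_{n_j}}\cap\mathbb L_{\delta_{n_j}}}|h_{\delta_{n_j}}(p)-H(p)|\longrightarrow0\qquad(j\to\infty).$$ -/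

import Mathlib

open Set Filter Topology MeasureTheory
open scoped ENNReal

namespace SemiDiscrete

/-- A (continuous) domain: an open, bounded, simply connected subset of the plane. -/
structure IsPlaneDomain (Ω : Set ℂ) : Prop where
  isOpen : IsOpen Ω
  isBounded : Bornology.IsBounded Ω
  simplyConnected : IsSimplyConnected Ω

/-- The primal semi-discrete lattice `δℤ × ℝ`. -/
def primalLattice (δ : ℝ) : Set ℂ := {p | ∃ k : ℤ, p.re = δ * k}

/-- The dual semi-discrete lattice `δ(ℤ + 1/2) × ℝ`. -/
def dualLattice (δ : ℝ) : Set ℂ := {p | ∃ k : ℤ, p.re = δ * (k + 1 / 2)}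

/-- The points `z 0, z 1, …, z (2n)` form a closed self-avoiding path on `δℤ × ℝ` whose segments
`[z 0, z 1], [z 1, z 2], …` are alternately horizontal and vertical, none of them reduced to a
point.  Self-avoiding means that two segments which are not cyclically consecutive are disjoint
(two consecutive ones are perpendicular, hence meet only at their common endpoint).  The values
`z j` with `j > 2n` are irrelevant. -/
structure IsPrimalContour (δ : ℝ) (n : ℕ) (z : ℕ → ℂ) : Prop where
  pos : 0 < n
  mem_lattice : ∀ j ≤ 2 * n, z j ∈ primalLattice δ
  horizontal : ∀ i < n, z (2 * i) ≠ z (2 * i + 1) ∧ (z (2 * i)).im = (z (2 * i + 1)).im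
  vertical : ∀ i < n,
    z (2 * i + 1) ≠ z (2 * i + 2) ∧ (z (2 * i + 1)).re = (z (2 * i + 2)).re
  closed : z (2 * n) = z 0
  selfAvoiding : ∀ i j : ℕ, i + 1 < j → j < 2 * n → ¬ (i = 0 ∧ j + 1 = 2 * n) →
    Disjoint (segment ℝ (z i) (z (i + 1))) (segment ℝ (z j) (z (j + 1)))

/-- The boundary curve drawn in the plane by the path `z 0, …, z (2n)`. -/
def contour (n : ℕ) (z : ℕ → ℂ) : Set ℂ :=
  ⋃ i ∈ Finset.range (2 * n), segment ℝ (z i) (z (i + 1))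

/-- The part of the plane enclosed by a set `γ`: the points off `γ` whose connected component in
the complement of `γ` is bounded.  When `γ` is a closed self-avoiding polygonal line, this is the
bounded component of the complement of `γ`. -/
def enclosed (γ : Set ℂ) : Set ℂ :=
  {p | p ∈ γᶜ ∧ Bornology.IsBounded (connectedComponentIn γᶜ p)}

/-- A primal domain of mesh size `δ`, given as the open region of the plane that is enclosed by a
closed self-avoiding path of the primal lattice. -/
def IsPrimalDomain (δ : ℝ) (D : Set ℂ) : Prop :=
  ∃ (n : ℕ) (z : ℕ → ℂ), IsPrimalContour δ n z ∧ D = enclosed (contour n z)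

/-- The vertices of a primal domain; a semi-discrete function on `D` is a function of these. -/
def primalVertices (δ : ℝ) (D : Set ℂ) : Set ℂ := D ∩ primalLattice δ

/-- `Int D`: the dual vertices in `D` having both primal neighbours in `D`. -/
def interiorDual (δ : ℝ) (D : Set ℂ) : Set ℂ :=
  {q | q ∈ D ∩ dualLattice δ ∧
    q + ((δ / 2 : ℝ) : ℂ) ∈ primalVertices δ D ∧ q - ((δ / 2 : ℝ) : ℂ) ∈ primalVertices δ D}

/-- `Int² D = Int (Int D)`: the primal vertices in `D` having both dual neighbours in `Int D`. -/
def interiorTwo (δ : ℝ) (D : Set ℂ) : Set ℂ :=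
  {p | p ∈ primalVertices δ D ∧
    p + ((δ / 2 : ℝ) : ℂ) ∈ interiorDual δ D ∧ p - ((δ / 2 : ℝ) : ℂ) ∈ interiorDual δ D}

section Functions

variable {𝕜 : Type*} [RCLike 𝕜]

/-- The restriction `y ↦ f (x + iy)` of `f` to the vertical line with abscissa `x`. -/
def column (f : ℂ → 𝕜) (x : ℝ) : ℝ → 𝕜 := fun y => f ⟨x, y⟩

/-- The semi-discrete Laplacian
`(f (p + δ) + f (p - δ) - 2 f p) / δ² + ∂²f/∂y² (p)`. -/
noncomputable def laplacian (δ : ℝ) (f : ℂ → 𝕜) (p : ℂ) : 𝕜 :=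
  (f (p + (δ : ℂ)) + f (p - (δ : ℂ)) - 2 * f p) / (δ : 𝕜) ^ 2
    + deriv (deriv (column f p.re)) p.im

/-- `f` is twice differentiable on the primal domain `D`, i.e. along its vertical lines.  As `D` is
open, this involves only the values of `f` at the vertices of `D`. -/
def TwiceDifferentiable (δ : ℝ) (D : Set ℂ) (f : ℂ → 𝕜) : Prop :=
  ∀ p ∈ primalVertices δ D, DifferentiableAt ℝ (column f p.re) p.im ∧
    DifferentiableAt ℝ (deriv (column f p.re)) p.im

/-- `f` is a semi-discrete harmonic function on the primal domain `D`. -/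
def IsHarmonic (δ : ℝ) (D : Set ℂ) (f : ℂ → 𝕜) : Prop :=
  TwiceDifferentiable δ D f ∧ ∀ p ∈ interiorTwo δ D, laplacian δ f p = 0

/-- The semi-discrete integral over the primal vertices in `S`:
`δ ∑ₖ ∫_{y : δk + iy ∈ S} g (δk + iy) dy`. -/
noncomputable def integralOn (δ : ℝ) (S : Set ℂ) (g : ℂ → ℝ≥0∞) : ℝ≥0∞ :=
  ENNReal.ofReal δ * ∑' k : ℤ, ∫⁻ y in {y : ℝ | (⟨δ * k, y⟩ : ℂ) ∈ S}, g ⟨δ * k, y⟩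

/-- `(D δ)`, `0 < δ < δ₀`, is a family of semi-discretizations of `Ω`: `D δ` is a primal domain of
mesh size `δ` lying in `Ω`, and `D δ` converges to `Ω` in the Carathéodory sense as `δ → 0`
(for domains contained in `Ω` this says that every compact subset of `Ω` is eventually contained
in `D δ`). -/
structure IsSemiDiscretization (Ω : Set ℂ) (δ₀ : ℝ) (D : ℝ → Set ℂ) : Prop where
  isPrimalDomain : ∀ δ, 0 < δ → δ < δ₀ → IsPrimalDomain δ (D δ)
  subset : ∀ δ, 0 < δ → δ < δ₀ → D δ ⊆ Ω
  exhausts : ∀ K ⊆ Ω, IsCompact K → ∀ᶠ δ in 𝓝[>] (0 : ℝ), K ⊆ D δ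

/-- The functions `h δ`, `0 < δ < δ₀`, on `D δ` are bounded on each compact subset of `Ω`,
uniformly in `δ`. -/
def UniformlyBoundedOnCompacts (Ω : Set ℂ) (δ₀ : ℝ) (D : ℝ → Set ℂ) (h : ℝ → ℂ → 𝕜) : Prop :=
  ∀ K ⊆ Ω, IsCompact K → ∃ M : ℝ, ∀ δ, 0 < δ → δ < δ₀ →
    ∀ p ∈ K ∩ primalVertices δ (D δ), ‖h δ p‖ ≤ M

/-- The semi-discrete integral of `|h δ|²` over each compact subset of `Ω` is bounded, uniformly
in `δ`. -/
def UniformlySquareIntegrableOnCompacts (Ω : Set ℂ) (δ₀ : ℝ) (D : ℝ → Set ℂ)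
    (h : ℝ → ℂ → 𝕜) : Prop :=
  ∀ K ⊆ Ω, IsCompact K → ∃ M : ℝ, 0 < M ∧ ∀ δ, 0 < δ → δ < δ₀ →
    integralOn δ (K ∩ D δ) (fun p => ‖h δ p‖ₑ ^ 2) ≤ ENNReal.ofReal M

/-- Precompactness, as `δ → 0`, of the family `h δ` of functions on the vertices of `D δ` for
uniform convergence on the compact subsets of `Ω`: along every sequence of mesh sizes tending to
`0` there is a subsequence along which the functions converge, uniformly on each compact subset
of `Ω`, to a continuous function on `Ω`. -/
def PrecompactOnCompacts (Ω : Set ℂ) (δ₀ : ℝ) (D : ℝ → Set ℂ) (h : ℝ → ℂ → 𝕜) : Prop :=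
  ∀ δ : ℕ → ℝ, (∀ n, 0 < δ n ∧ δ n < δ₀) → Tendsto δ atTop (𝓝 0) →
    ∃ φ : ℕ → ℕ, StrictMono φ ∧ ∃ H : ℂ → 𝕜, ContinuousOn H Ω ∧
      ∀ K ⊆ Ω, IsCompact K → ∀ ε > 0, ∀ᶠ n in atTop,
        ∀ p ∈ K ∩ primalVertices (δ (φ n)) (D (δ (φ n))), ‖h (δ (φ n)) p - H p‖ < ε

end Functions

end SemiDiscrete

/-! The argument is interior elliptic regularity with constants independent of the mesh, followed by
Arzelà–Ascoli.

For a semi-discrete harmonic `u`, the Laplacian of `u²` is the sum of the squares of the forward and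
backward horizontal difference quotients and of twice the squared vertical derivative. Testing this
identity against a smooth cutoff and moving the Laplacian onto the cutoff gives the Caccioppoli
inequality `exists_boxEnergy_gradient_le`: the `L²` norm of the gradient on a box is controlled by
that of `u` on a larger box. Difference quotients and vertical derivatives of `u` are again harmonic
on slightly smaller boxes, so the inequality can be iterated. Control of `u`, both first derivatives
and the mixed second derivative in `L²` bounds `u` pointwise, through one-dimensional Sobolev
inequalities in each direction; applied to the first derivatives this yields
`exists_sq_gradient_le_boxEnergy`.

Both assumptions of the theorem bound the energies on small boxes (`LocallyBoundedEnergy`), hence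
give local Lipschitz bounds on the lattice. Extended to the plane as step functions, the `h δ` are
equicontinuous up to jumps of order `δ`, which is enough for the compactness lemma
`exists_subseq_tendstoUniformlyOn`. -/

namespace SemiDiscrete

/-! ### Harmonicity and energy on lattice boxes -/

/-- The columns `k` of the lattice `δℤ × ℝ` with `|δ k| ≤ s`. -/
noncomputable def boxColumns (δ s : ℝ) : Finset ℤ := Finset.Icc ⌈-s / δ⌉ ⌊s / δ⌋

theorem mem_boxColumns {δ : ℝ} (hδ : 0 < δ) {s : ℝ} {k : ℤ} :
    k ∈ boxColumns δ s ↔ |δ * k| ≤ s := by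
  rw [boxColumns, Finset.mem_Icc, Int.ceil_le, Int.le_floor, div_le_iff₀ hδ, le_div_iff₀ hδ,
    abs_le, mul_comm δ]

theorem boxColumns_subset {δ : ℝ} (hδ : 0 < δ) {s t : ℝ} (hst : s ≤ t) :
    boxColumns δ s ⊆ boxColumns δ t := fun k hk => by
  rw [mem_boxColumns hδ] at hk ⊢
  exact hk.trans hst

/-- `u` is semi-discrete harmonic at the points `(δ k, y)` with `|δ k| ≤ s` and `|y| ≤ s`. -/
def IsHarmonicOnBox (δ s : ℝ) (u : ℤ → ℝ → ℝ) : Prop :=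
  ∀ k : ℤ, ∀ y : ℝ, |δ * k| ≤ s → |y| ≤ s → DifferentiableAt ℝ (u k) y ∧
    HasDerivAt (deriv (u k)) (-((u (k + 1) y + u (k - 1) y - 2 * u k y) / δ ^ 2)) y

/-- The square of the semi-discrete `L²` norm of `v` over the box `[-s, s]²`. -/
noncomputable def boxEnergy (δ s : ℝ) (v : ℤ → ℝ → ℝ) : ℝ :=
  δ * ∑ k ∈ boxColumns δ s, ∫ y in -s..s, v k y ^ 2

/-- The forward difference quotient in the horizontal direction. -/
noncomputable def forwardDiff (δ : ℝ) (u : ℤ → ℝ → ℝ) : ℤ → ℝ → ℝ :=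
  fun k y => (u (k + 1) y - u k y) / δ

/-- The derivative along the columns. -/
noncomputable def columnDeriv (u : ℤ → ℝ → ℝ) : ℤ → ℝ → ℝ := fun k => deriv (u k)

theorem abs_mul_add_one_le {δ s : ℝ} (hδ : 0 < δ) {k : ℤ} (hk : |δ * k| ≤ s - δ) :
    |δ * ((k + 1 : ℤ) : ℝ)| ≤ s := by
  rw [abs_le] at hk ⊢; push_cast; constructor <;> nlinarith [hk.1, hk.2]

theorem abs_mul_sub_one_le {δ s : ℝ} (hδ : 0 < δ) {k : ℤ} (hk : |δ * k| ≤ s - δ) :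
    |δ * ((k - 1 : ℤ) : ℝ)| ≤ s := by
  rw [abs_le] at hk ⊢; push_cast; constructor <;> nlinarith [hk.1, hk.2]

namespace IsHarmonicOnBox

variable {δ s : ℝ} {u : ℤ → ℝ → ℝ}

theorem mono (h : IsHarmonicOnBox δ s u) {t : ℝ} (hts : t ≤ s) : IsHarmonicOnBox δ t u :=
  fun k y hk hy => h k y (hk.trans hts) (hy.trans hts)

theorem continuousOn (h : IsHarmonicOnBox δ s u) {k : ℤ} (hk : |δ * k| ≤ s) :
    ContinuousOn (u k) (Icc (-s) s) := fun y hy =>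
  (h k y hk (abs_le.2 hy)).1.continuousAt.continuousWithinAt

theorem continuousOn_columnDeriv (h : IsHarmonicOnBox δ s u) {k : ℤ} (hk : |δ * k| ≤ s) :
    ContinuousOn (columnDeriv u k) (Icc (-s) s) := fun y hy =>
  (h k y hk (abs_le.2 hy)).2.continuousAt.continuousWithinAt

theorem eventually_abs_le {y : ℝ} (hδ : 0 < δ) (hy : |y| ≤ s - δ) : ∀ᶠ z in 𝓝 y, |z| ≤ s :=
  (continuous_abs.continuousAt.eventually_lt continuousAt_const (by linarith : |y| < s)).mono
    fun _ hz => hz.le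

/-- The equation is linear and invariant under lattice translations. The box shrinks by `δ` so that
the column `k + 1` stays in the original box; the strict margin in `y` lets derivatives be compared
on a neighbourhood. -/
theorem forwardDiff (hδ : 0 < δ) (h : IsHarmonicOnBox δ s u) :
    IsHarmonicOnBox δ (s - δ) (forwardDiff δ u) := by
  intro k y hk hy
  have hk0 : |δ * k| ≤ s := by linarith
  have hk1 := abs_mul_add_one_le hδ hk
  have hys : |y| ≤ s := by linarith
  have hev : deriv (SemiDiscrete.forwardDiff δ u k) =ᶠ[𝓝 y]
      fun z => (deriv (u (k + 1)) z - deriv (u k) z) / δ := by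
    filter_upwards [eventually_abs_le hδ hy] with z hz
    exact (((h _ z hk1 hz).1.hasDerivAt.sub (h _ z hk0 hz).1.hasDerivAt).div_const δ).deriv
  refine ⟨((h _ y hk1 hys).1.sub (h _ y hk0 hys).1).div_const δ, ?_⟩
  refine HasDerivAt.congr_of_eventuallyEq ?_ hev
  refine (((h _ y hk1 hys).2.sub (h _ y hk0 hys).2).div_const δ).congr_deriv ?_
  unfold SemiDiscrete.forwardDiff
  rw [show k + 1 - 1 = k by ring, show k - 1 + 1 = k by ring]
  ring

/-- The equation expresses the second derivative of a column through values of `u`, which are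
themselves differentiable; hence a third derivative exists and solves the differentiated equation.
-/
theorem columnDeriv (hδ : 0 < δ) (h : IsHarmonicOnBox δ s u) :
    IsHarmonicOnBox δ (s - δ) (columnDeriv u) := by
  intro k y hk hy
  have hk0 : |δ * k| ≤ s := by linarith
  have hk1 := abs_mul_add_one_le hδ hk
  have hk2 := abs_mul_sub_one_le hδ hk
  have hys : |y| ≤ s := by linarith
  have hev : deriv (SemiDiscrete.columnDeriv u k) =ᶠ[𝓝 y]
      fun z => -((u (k + 1) z + u (k - 1) z - 2 * u k z) / δ ^ 2) := by
    filter_upwards [eventually_abs_le hδ hy] with z hz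
    exact (h _ z hk0 hz).2.deriv
  refine ⟨(h _ y hk0 hys).2.differentiableAt, ?_⟩
  refine HasDerivAt.congr_of_eventuallyEq ?_ hev
  exact ((((h _ y hk1 hys).1.hasDerivAt.add (h _ y hk2 hys).1.hasDerivAt).sub
    ((h _ y hk0 hys).1.hasDerivAt.const_mul 2)).div_const (δ ^ 2)).neg

end IsHarmonicOnBox

theorem boxEnergy_nonneg {δ : ℝ} (hδ : 0 < δ) {s : ℝ} (hs : 0 ≤ s) (v : ℤ → ℝ → ℝ) :
    0 ≤ boxEnergy δ s v :=
  mul_nonneg hδ.le <| Finset.sum_nonneg fun _ _ =>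
    intervalIntegral.integral_nonneg (by linarith) fun _ _ => sq_nonneg _

theorem intervalIntegrable_of_continuousOn_box {s : ℝ} (hs : 0 ≤ s) {f : ℝ → ℝ}
    (hf : ContinuousOn f (Icc (-s) s)) : IntervalIntegrable f volume (-s) s :=
  ContinuousOn.intervalIntegrable (by rwa [uIcc_of_le (by linarith)])

theorem boxEnergy_mono {δ : ℝ} (hδ : 0 < δ) {s t : ℝ} (hs : 0 ≤ s) (hst : s ≤ t)
    {v : ℤ → ℝ → ℝ} (hv : ∀ k : ℤ, |δ * k| ≤ t → ContinuousOn (v k) (Icc (-t) t)) :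
    boxEnergy δ s v ≤ boxEnergy δ t v := by
  refine mul_le_mul_of_nonneg_left ?_ hδ.le
  refine (Finset.sum_le_sum fun k hk => ?_).trans
    (Finset.sum_le_sum_of_subset_of_nonneg (boxColumns_subset hδ hst) fun k _ _ =>
      intervalIntegral.integral_nonneg (by linarith) fun _ _ => sq_nonneg _)
  refine intervalIntegral.integral_mono_interval (by linarith) (by linarith) hst
    (Eventually.of_forall fun _ => sq_nonneg _) ?_
  exact intervalIntegrable_of_continuousOn_box (hs.trans hst)
    ((hv k (((mem_boxColumns hδ).1 hk).trans hst)).pow 2)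

/-! ### Cutoffs and summation by parts -/

theorem exists_cutoff {s t : ℝ} (hs : 0 < s) (hst : s < t) :
    ∃ χ χ' χ'' : ℝ → ℝ, (∀ x, HasDerivAt χ (χ' x) x) ∧ (∀ x, HasDerivAt χ' (χ'' x) x) ∧
      Continuous χ'' ∧ (∀ x, 0 ≤ χ x) ∧ (∀ x, χ x ≤ 1) ∧ (∀ x, |x| ≤ s → χ x = 1) ∧
      (∀ x, t ≤ |x| → χ x = 0) ∧ (∀ x, t < |x| → χ' x = 0) ∧ ∃ B, ∀ x, |χ'' x| ≤ B := by
  let χ : ContDiffBump (0 : ℝ) := ⟨s, t, hs, hst⟩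
  have h2 : ContDiff ℝ 2 χ := χ.contDiff
  have h1 : ContDiff ℝ 1 (deriv χ) := h2.deriv'
  have h0 : Continuous (deriv (deriv χ)) := h1.continuous_deriv le_rfl
  have hzero : ∀ x, t ≤ |x| → χ x = 0 := fun x hx =>
    χ.zero_of_le_dist (by simpa [Real.dist_eq] using hx)
  refine ⟨χ, deriv χ, deriv (deriv χ), fun x => (h2.differentiable (by norm_num) x).hasDerivAt,
    fun x => (h1.differentiable (by norm_num) x).hasDerivAt, h0, fun x => χ.nonneg,
    fun x => χ.le_one, fun x hx => χ.one_of_mem_closedBall (by simpa using hx), hzero,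
    fun x hx => ?_, ?_⟩
  · have : (χ : ℝ → ℝ) =ᶠ[𝓝 x] fun _ => 0 := by
      filter_upwards [continuousAt_const.eventually_lt continuous_abs.continuousAt hx] with z hz
      exact hzero z hz.le
    rw [this.deriv_eq, deriv_const]
  · obtain ⟨B, hB⟩ := h0.bounded_above_of_compact_support χ.hasCompactSupport.deriv.deriv
    exact ⟨B, fun x => by simpa using hB x⟩

/-- Mean value inequality twice: first for `χ'`, then for `y ↦ χ (y + δ) - χ y` between `x - δ` and
`x`. -/
theorem abs_secondDiff_le {χ χ' χ'' : ℝ → ℝ} (h1 : ∀ x, HasDerivAt χ (χ' x) x)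
    (h2 : ∀ x, HasDerivAt χ' (χ'' x) x) {B : ℝ} (hB : ∀ x, |χ'' x| ≤ B) (x : ℝ) {δ : ℝ}
    (hδ : 0 < δ) : |χ (x + δ) + χ (x - δ) - 2 * χ x| ≤ B * δ ^ 2 := by
  have hχ' : ∀ y, |χ' (y + δ) - χ' y| ≤ B * δ := fun y => by
    have := Convex.norm_image_sub_le_of_norm_hasDerivWithin_le (f := χ') (f' := χ'') (C := B)
      (s := univ) (x := y) (y := y + δ) (fun z _ => (h2 z).hasDerivWithinAt) (fun z _ => hB z)
      convex_univ (mem_univ _) (mem_univ _)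
    simpa [abs_of_pos hδ] using this
  have := Convex.norm_image_sub_le_of_norm_hasDerivWithin_le (f := fun y => χ (y + δ) - χ y)
    (f' := fun y => χ' (y + δ) - χ' y) (C := B * δ)
      (s := univ) (x := x - δ) (y := x)
      (fun z _ => (((h1 (z + δ)).comp_add_const z δ).sub (h1 z)).hasDerivWithinAt)
      (fun z _ => hχ' z) convex_univ (mem_univ _) (mem_univ _)
  simp only [sub_add_cancel, sub_sub_cancel, Real.norm_eq_abs, abs_of_pos hδ] at this
  calc _ = |χ (x + δ) - χ x - (χ x - χ (x - δ))| := by congr 1; ring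
    _ ≤ B * δ * δ := this
    _ = _ := by ring

theorem sum_mul_shift (S : Finset ℤ) (a w : ℤ → ℝ) (m : ℤ)
    (h0 : ∀ k ∉ S, a k = 0) (h1 : ∀ k ∉ S, a (k - m) = 0) :
    ∑ k ∈ S, a k * w (k + m) = ∑ k ∈ S, a (k - m) * w k := by
  rw [← tsum_eq_sum (L := .unconditional ℤ) (s := S) (f := fun k => a k * w (k + m)) fun k hk => by simp [h0 k hk],
    ← tsum_eq_sum (L := .unconditional ℤ) (s := S) (f := fun k => a (k - m) * w k) fun k hk => by simp [h1 k hk],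
    ← (Equiv.addRight m).tsum_eq fun k => a (k - m) * w k]
  simp

/-- The discrete second difference is self-adjoint; the vanishing of `a` at and next to every point
outside `S` removes the boundary terms. -/
theorem sum_mul_secondDiff (S : Finset ℤ) (a w : ℤ → ℝ)
    (h : ∀ k ∉ S, a k = 0 ∧ a (k + 1) = 0 ∧ a (k - 1) = 0) :
    ∑ k ∈ S, a k * (w (k + 1) + w (k - 1) - 2 * w k) =
      ∑ k ∈ S, (a (k + 1) + a (k - 1) - 2 * a k) * w k := by
  have e1 := sum_mul_shift S a w 1 (fun k hk => (h k hk).1) (fun k hk => (h k hk).2.2)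
  have e2 := sum_mul_shift S a w (-1) (fun k hk => (h k hk).1)
    (fun k hk => by simpa using (h k hk).2.1)
  simp only [sub_neg_eq_add, ← sub_eq_add_neg] at e2
  calc _ = ∑ k ∈ S, a k * w (k + 1) + ∑ k ∈ S, a k * w (k - 1) - 2 * ∑ k ∈ S, a k * w k := by
        rw [Finset.mul_sum, ← Finset.sum_add_distrib, ← Finset.sum_sub_distrib]
        exact Finset.sum_congr rfl fun _ _ => by ring
    _ = _ := by
        rw [e1, e2, Finset.mul_sum, ← Finset.sum_add_distrib, ← Finset.sum_sub_distrib]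
        exact Finset.sum_congr rfl fun _ _ => by ring

/-! ### The Caccioppoli inequality -/

/-- Green's identity on one column, tested with `χ`, for the Laplacian of `u²`. -/
theorem integral_cutoff_mul_gradient_sq {δ s t : ℝ} (hδ : 0 < δ) (hts : t < s) (ht : 0 < t)
    {u : ℤ → ℝ → ℝ} (hu : IsHarmonicOnBox δ s u) {χ χ' χ'' : ℝ → ℝ}
    (h1 : ∀ x, HasDerivAt χ (χ' x) x) (h2 : ∀ x, HasDerivAt χ' (χ'' x) x) (h3 : Continuous χ'')
    (h0 : ∀ x, t ≤ |x| → χ x = 0) (h0' : ∀ x, t < |x| → χ' x = 0) {k : ℤ}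
    (hk : |δ * k| ≤ s - δ) :
    ∫ y in -s..s, χ y * (2 * columnDeriv u k y ^ 2 + forwardDiff δ u k y ^ 2
        + forwardDiff δ u (k - 1) y ^ 2) =
      (∫ y in -s..s, χ'' y * u k y ^ 2) +
        ((∫ y in -s..s, χ y * u (k + 1) y ^ 2) + (∫ y in -s..s, χ y * u (k - 1) y ^ 2)
          - 2 * ∫ y in -s..s, χ y * u k y ^ 2) / δ ^ 2 := by
  have hs : 0 < s := ht.trans hts
  have hk0 : |δ * k| ≤ s := by linarith
  have hk1 := abs_mul_add_one_le hδ hk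
  have hk2 := abs_mul_sub_one_le hδ hk
  have c0 := hu.continuousOn hk0
  have c1 := hu.continuousOn hk1
  have c2 := hu.continuousOn hk2
  have cd := hu.continuousOn_columnDeriv hk0
  have cχ : ContinuousOn χ (Icc (-s) s) := fun x _ => (h1 x).continuousAt.continuousWithinAt
  have cχ'' : ContinuousOn χ'' (Icc (-s) s) := h3.continuousOn
  have iI : ∀ {f : ℝ → ℝ}, ContinuousOn f (Icc (-s) s) → IntervalIntegrable f volume (-s) s :=
    fun hf => intervalIntegrable_of_continuousOn_box hs.le hf
  have cf1 : ContinuousOn (forwardDiff δ u k) (Icc (-s) s) := (c1.sub c0).div_const δ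
  have cf2 : ContinuousOn (forwardDiff δ u (k - 1)) (Icc (-s) s) := by
    unfold forwardDiff
    rw [show k - 1 + 1 = k by ring]
    exact (c0.sub c2).div_const δ
  have ia : IntervalIntegrable (fun y => χ y * (2 * columnDeriv u k y ^ 2 +
      forwardDiff δ u k y ^ 2 + forwardDiff δ u (k - 1) y ^ 2)) volume (-s) s :=
    iI (cχ.mul (((cd.pow 2).const_mul 2 |>.add (cf1.pow 2)).add (cf2.pow 2)))
  have ib : IntervalIntegrable (fun y => χ'' y * u k y ^ 2) volume (-s) s :=
    iI (cχ''.mul (c0.pow 2))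
  have ic1 : IntervalIntegrable (fun y => χ y * u (k + 1) y ^ 2) volume (-s) s :=
    iI (cχ.mul (c1.pow 2))
  have ic2 : IntervalIntegrable (fun y => χ y * u (k - 1) y ^ 2) volume (-s) s :=
    iI (cχ.mul (c2.pow 2))
  have ic0 : IntervalIntegrable (fun y => χ y * u k y ^ 2) volume (-s) s :=
    iI (cχ.mul (c0.pow 2))
  -- The primitive is `χ (u²)' - χ' u²`, with derivative `χ (u²)'' - χ'' u²`. By the equation,
  -- `(u²)''` is the sum of the gradient squares minus the horizontal second difference quotient of
  -- `u²`. The primitive vanishes at `±s` because `t < s`.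
  have key := intervalIntegral.integral_eq_sub_of_hasDerivAt
    (f := fun y => χ y * (2 * (u k y * columnDeriv u k y)) - χ' y * u k y ^ 2)
    (f' := fun y => χ y * (2 * columnDeriv u k y ^ 2 + forwardDiff δ u k y ^ 2
        + forwardDiff δ u (k - 1) y ^ 2) - (χ'' y * u k y ^ 2 +
        (χ y * u (k + 1) y ^ 2 + χ y * u (k - 1) y ^ 2 - 2 * (χ y * u k y ^ 2)) / δ ^ 2))
    (a := -s) (b := s) ?_ ?_
  · rw [intervalIntegral.integral_sub ia
        (ib.add (((ic1.add ic2).sub (ic0.const_mul 2)).div_const _)),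
      intervalIntegral.integral_add ib (((ic1.add ic2).sub (ic0.const_mul 2)).div_const _),
      intervalIntegral.integral_div, intervalIntegral.integral_sub (ic1.add ic2)
        (ic0.const_mul 2), intervalIntegral.integral_add ic1 ic2,
      intervalIntegral.integral_const_mul] at key
    have z1 : t < |s| := by rwa [abs_of_pos hs]
    have z2 : t < |-s| := by rwa [abs_neg]
    simp only [h0 s z1.le, h0 (-s) z2.le, h0' s z1, h0' (-s) z2, zero_mul, sub_zero] at key
    linarith
  · intro y hy
    rw [uIcc_of_le (by linarith)] at hy
    have hy' : |y| ≤ s := abs_le.2 hy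
    obtain ⟨d1, d2⟩ := hu k y hk0 hy'
    have D := ((h1 y).mul ((d1.hasDerivAt.mul d2).const_mul 2)).sub
      ((h2 y).mul (d1.hasDerivAt.pow 2))
    refine D.congr_deriv ?_
    simp only [columnDeriv, forwardDiff, Pi.mul_apply, Pi.pow_apply]
    rw [show k - 1 + 1 = k by ring]
    field_simp
    ring
  · exact ia.sub (ib.add (((ic1.add ic2).sub (ic0.const_mul 2)).div_const _))

/-- The Caccioppoli inequality. -/
theorem exists_boxEnergy_gradient_le {s' s : ℝ} (hs' : 0 < s') (hss : s' < s) :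
    ∃ C, 0 ≤ C ∧ ∀ δ, 0 < δ → δ ≤ (s - s') / 2 → ∀ u, IsHarmonicOnBox δ s u →
      boxEnergy δ s' (columnDeriv u) + boxEnergy δ s' (forwardDiff δ u)
        ≤ C * boxEnergy δ s u := by
  -- The midpoint leaves room on both sides: `s' < t`, and `t ≤ s - δ` since `δ ≤ (s - s') / 2`, so
  -- every column meeting the support of the cutoff has its neighbours in the box.
  set t := (s + s') / 2 with ht
  obtain ⟨χ, χ', χ'', h1, h2, h3, hχ0, hχ1, hone, h0, h0', B, hB⟩ :=
    exists_cutoff hs' (show s' < t by rw [ht]; linarith)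
  have hB0 : 0 ≤ B := (abs_nonneg _).trans (hB 0)
  refine ⟨2 * B, by positivity, fun δ hδ hδs u hu => ?_⟩
  have hs : 0 < s := hs'.trans hss
  have hts : t < s := by rw [ht]; linarith
  have htδ : t ≤ s - δ := by rw [ht]; linarith
  have hst' : s' ≤ t := by rw [ht]; linarith
  have cχ : ContinuousOn χ (Icc (-s) s) := fun x _ => (h1 x).continuousAt.continuousWithinAt
  have iI : ∀ {f : ℝ → ℝ}, ContinuousOn f (Icc (-s) s) → IntervalIntegrable f volume (-s) s :=
    fun hf => intervalIntegrable_of_continuousOn_box hs.le hf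
  have iI' : ∀ {f : ℝ → ℝ}, ContinuousOn f (Icc (-s) s) → IntervalIntegrable f volume (-s') s' :=
    fun hf => intervalIntegrable_of_continuousOn_box hs'.le
      (hf.mono (Icc_subset_Icc (by linarith) hss.le))
  set S := boxColumns δ s with hS
  set G : ℤ → ℝ := fun k => ∫ y in -s..s, χ y * (2 * columnDeriv u k y ^ 2 +
    forwardDiff δ u k y ^ 2 + forwardDiff δ u (k - 1) y ^ 2) with hG
  set W : ℤ → ℝ := fun k => ∫ y in -s..s, χ y * u k y ^ 2 with hW
  set Q : ℤ → ℝ := fun k => ∫ y in -s..s, u k y ^ 2 with hQ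
  have hG0 : ∀ k, 0 ≤ G k := fun k => intervalIntegral.integral_nonneg (by linarith)
    fun y _ => mul_nonneg (hχ0 y) (by positivity)
  have hW0 : ∀ k, 0 ≤ W k := fun k => intervalIntegral.integral_nonneg (by linarith)
    fun y _ => mul_nonneg (hχ0 y) (by positivity)
  have hcu : ∀ k ∈ S, ContinuousOn (u k) (Icc (-s) s) := fun k hk =>
    hu.continuousOn ((mem_boxColumns hδ).1 hk)
  have hWQ : ∀ k ∈ S, W k ≤ Q k := fun k hk =>
    intervalIntegral.integral_mono_on (by linarith) (iI (cχ.mul ((hcu k hk).pow 2)))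
      (iI ((hcu k hk).pow 2)) fun y _ => mul_le_of_le_one_left (sq_nonneg _) (hχ1 y)
  have hBQ : ∀ k ∈ S, ∫ y in -s..s, χ'' y * u k y ^ 2 ≤ B * Q k := fun k hk => by
    rw [hQ, ← intervalIntegral.integral_const_mul]
    exact intervalIntegral.integral_mono_on (by linarith)
      (iI (h3.continuousOn.mul ((hcu k hk).pow 2))) (iI (((hcu k hk).pow 2).const_mul B))
      fun y _ => mul_le_mul_of_nonneg_right (le_of_abs_le (hB y)) (sq_nonneg _)
  have hQ0 : ∀ k, 0 ≤ Q k := fun k => intervalIntegral.integral_nonneg (by linarith)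
    fun y _ => sq_nonneg _
  -- the upper bound
  have hid : ∀ k ∈ S, χ (δ * k) * G k = χ (δ * k) * (∫ y in -s..s, χ'' y * u k y ^ 2) +
      (χ (δ * k) * (W (k + 1) + W (k - 1) - 2 * W k)) / δ ^ 2 := by
    intro k hk
    by_cases hkt : |δ * k| ≤ t
    · have := integral_cutoff_mul_gradient_sq hδ hts (hs'.trans_le hst') hu h1 h2 h3 h0 h0'
        (hkt.trans htδ)
      rw [show G k = _ from this]
      ring
    · simp [h0 _ (not_le.1 hkt).le]
  have hzero : ∀ k ∉ S, χ (δ * k) = 0 ∧ χ (δ * ((k + 1 : ℤ) : ℝ)) = 0 ∧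
      χ (δ * ((k - 1 : ℤ) : ℝ)) = 0 := by
    intro k hk
    rw [hS, mem_boxColumns hδ, not_le] at hk
    refine ⟨h0 _ (by linarith), h0 _ ?_, h0 _ ?_⟩
    · by_contra hcon
      have := abs_mul_sub_one_le (s := s) hδ (k := k + 1) (by linarith)
      rw [show k + 1 - 1 = k by ring] at this
      linarith
    · by_contra hcon
      have := abs_mul_add_one_le (s := s) hδ (k := k - 1) (by linarith)
      rw [show k - 1 + 1 = k by ring] at this
      linarith
  -- After summation by parts the second difference falls on `χ`, where it is at most `B δ²` and
  -- absorbs the factor `δ⁻²`. The vertical and the horizontal terms each contribute `B * Q k`.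
  have hup : ∑ k ∈ S, χ (δ * k) * G k ≤ 2 * B * ∑ k ∈ S, Q k := by
    rw [Finset.sum_congr rfl hid, Finset.sum_add_distrib, ← Finset.sum_div,
      sum_mul_secondDiff S (fun k => χ (δ * k)) W hzero, Finset.sum_div, ← Finset.sum_add_distrib,
      Finset.mul_sum]
    refine Finset.sum_le_sum fun k hk => ?_
    have e1 : χ (δ * k) * (∫ y in -s..s, χ'' y * u k y ^ 2) ≤ B * Q k :=
      (mul_le_mul_of_nonneg_left (hBQ k hk) (hχ0 _)).trans
        (mul_le_of_le_one_left (mul_nonneg hB0 (hQ0 k)) (hχ1 _))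
    have e2 := le_of_abs_le (abs_secondDiff_le h1 h2 hB (δ * k) hδ)
    have e3 : (χ (δ * ((k + 1 : ℤ) : ℝ)) + χ (δ * ((k - 1 : ℤ) : ℝ)) - 2 * χ (δ * k)) * W k / δ ^ 2
        ≤ B * Q k := by
      rw [div_le_iff₀ (by positivity)]
      push_cast
      rw [mul_add, mul_sub, mul_one]
      calc _ ≤ B * δ ^ 2 * W k := mul_le_mul_of_nonneg_right e2 (hW0 k)
        _ ≤ B * δ ^ 2 * Q k := mul_le_mul_of_nonneg_left (hWQ k hk) (by positivity)
        _ = _ := by ring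
    linarith
  -- the lower bound
  have hlow : ∑ k ∈ boxColumns δ s', ((∫ y in -s'..s', columnDeriv u k y ^ 2) +
      ∫ y in -s'..s', forwardDiff δ u k y ^ 2) ≤ ∑ k ∈ S, χ (δ * k) * G k := by
    refine (Finset.sum_le_sum fun k hk => ?_).trans
      (Finset.sum_le_sum_of_subset_of_nonneg (boxColumns_subset hδ hss.le) fun k _ _ =>
        mul_nonneg (hχ0 _) (hG0 k))
    have hks' := (mem_boxColumns hδ).1 hk
    have hks : |δ * k| ≤ s - δ := hks'.trans (hst'.trans htδ)
    have hk0 : |δ * k| ≤ s := by linarith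
    have c0 := hu.continuousOn hk0
    have c1 := hu.continuousOn (abs_mul_add_one_le hδ hks)
    have c2 := hu.continuousOn (abs_mul_sub_one_le hδ hks)
    have cd := hu.continuousOn_columnDeriv hk0
    have cf1 : ContinuousOn (forwardDiff δ u k) (Icc (-s) s) := (c1.sub c0).div_const δ
    have cf2 : ContinuousOn (forwardDiff δ u (k - 1)) (Icc (-s) s) := by
      unfold forwardDiff
      rw [show k - 1 + 1 = k by ring]
      exact (c0.sub c2).div_const δ
    have cG : ContinuousOn (fun y => χ y * (2 * columnDeriv u k y ^ 2 +
        forwardDiff δ u k y ^ 2 + forwardDiff δ u (k - 1) y ^ 2)) (Icc (-s) s) :=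
      cχ.mul (((cd.pow 2).const_mul 2 |>.add (cf1.pow 2)).add (cf2.pow 2))
    have id2 := iI' (cd.pow 2)
    have if2 := iI' (cf1.pow 2)
    simp only [Pi.pow_def] at id2 if2
    rw [hone _ hks', one_mul, ← intervalIntegral.integral_add id2 if2]
    calc _ ≤ ∫ y in -s'..s', χ y * (2 * columnDeriv u k y ^ 2 +
        forwardDiff δ u k y ^ 2 + forwardDiff δ u (k - 1) y ^ 2) :=
          intervalIntegral.integral_mono_on (by linarith) (id2.add if2)
            (iI' cG) fun y hy => by
              rw [hone y (abs_le.2 hy), one_mul]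
              nlinarith [sq_nonneg (columnDeriv u k y), sq_nonneg (forwardDiff δ u (k - 1) y)]
      _ ≤ _ := intervalIntegral.integral_mono_interval (by linarith) (by linarith) hss.le
          (Eventually.of_forall fun y => mul_nonneg (hχ0 y) (by positivity)) (iI cG)
  rw [boxEnergy, boxEnergy, boxEnergy, ← mul_add, ← Finset.sum_add_distrib]
  calc _ ≤ δ * (2 * B * ∑ k ∈ S, Q k) := mul_le_mul_of_nonneg_left (hlow.trans hup) hδ.le
    _ = _ := by ring

/-! ### Sobolev inequalities and pointwise bounds -/

/-- Since `-2 f f' ≤ f² + f'²`, integrating `(f²)'` gives `f 0 ^ 2 ≤ f y ^ 2 + A`; this is then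
integrated over `y ∈ [0, s]`. -/
theorem mul_sq_le_integral {s : ℝ} (hs : 0 < s) {f f' : ℝ → ℝ}
    (hf : ∀ y, |y| ≤ s → HasDerivAt f (f' y) y) (hf' : ContinuousOn f' (Icc (-s) s)) :
    s * f 0 ^ 2 ≤ (1 + s) * ((∫ y in -s..s, f y ^ 2) + ∫ y in -s..s, f' y ^ 2) := by
  have hc : ContinuousOn f (Icc (-s) s) := fun y hy =>
    (hf y (abs_le.2 hy)).continuousAt.continuousWithinAt
  have i1 := intervalIntegrable_of_continuousOn_box hs.le (hc.pow 2)
  have i2 := intervalIntegrable_of_continuousOn_box hs.le (hf'.pow 2)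
  have hsub : ∀ {g : ℝ → ℝ} {y : ℝ}, 0 ≤ y → y ≤ s → ContinuousOn g (Icc (-s) s) →
      IntervalIntegrable g volume 0 y := fun h0 hy hg => by
    refine ContinuousOn.intervalIntegrable (hg.mono ?_)
    rw [uIcc_of_le h0]
    exact Icc_subset_Icc (by linarith) hy
  set A := (∫ y in -s..s, f y ^ 2) + ∫ y in -s..s, f' y ^ 2 with hA
  have hA' : A = ∫ y in -s..s, (f y ^ 2 + f' y ^ 2) := (intervalIntegral.integral_add i1 i2).symm
  have key : ∀ y ∈ Icc 0 s, f 0 ^ 2 ≤ f y ^ 2 + A := by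
    rintro y ⟨h0, hy⟩
    have hFTC := intervalIntegral.integral_eq_sub_of_hasDerivAt (a := 0) (b := y)
      (f := fun z => f z ^ 2) (f' := fun z => 2 * (f z * f' z)) (fun z hz => by
        rw [uIcc_of_le h0] at hz
        refine ((hf z (abs_le.2 ⟨by linarith [hz.1], by linarith [hz.2]⟩)).pow 2).congr_deriv ?_
        ring) (hsub h0 hy ((hc.mul hf').const_mul 2))
    have h1 : -(∫ z in 0..y, 2 * (f z * f' z)) ≤ ∫ z in 0..y, (f z ^ 2 + f' z ^ 2) := by
      rw [← intervalIntegral.integral_neg]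
      exact intervalIntegral.integral_mono_on h0 (hsub h0 hy ((hc.mul hf').const_mul 2)).neg
        (hsub h0 hy ((hc.pow 2).add (hf'.pow 2))) fun z _ => by nlinarith [sq_nonneg (f z + f' z)]
    have h2 : ∫ z in 0..y, (f z ^ 2 + f' z ^ 2) ≤ A := by
      rw [hA']
      exact intervalIntegral.integral_mono_interval (by linarith) h0 hy
        (Eventually.of_forall fun z => by positivity) (i1.add i2)
    linarith
  have i3 := hsub hs.le le_rfl (hc.pow 2)
  simp only [Pi.pow_def] at i3
  have h1 : ∫ _ in 0..s, f 0 ^ 2 ≤ ∫ y in 0..s, (f y ^ 2 + A) :=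
    intervalIntegral.integral_mono_on hs.le (by simp)
      (i3.add (by simp)) key
  rw [intervalIntegral.integral_add i3 (by simp),
    intervalIntegral.integral_const, intervalIntegral.integral_const] at h1
  have h2 : ∫ y in 0..s, f y ^ 2 ≤ A := by
    have e1 : ∫ y in 0..s, f y ^ 2 ≤ ∫ y in -s..s, f y ^ 2 :=
      intervalIntegral.integral_mono_interval (by linarith) hs.le le_rfl
        (Eventually.of_forall fun z => sq_nonneg _) i1
    have e2 : 0 ≤ ∫ y in -s..s, f' y ^ 2 :=
      intervalIntegral.integral_nonneg (by linarith) fun _ _ => sq_nonneg _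
    linarith
  simp only [sub_zero, smul_eq_mul] at h1
  linarith

/-- Discrete counterpart of `mul_sq_le_integral`: chaining the hypothesis from column `0` to column
`j` bounds `W 0` by `W j + 2 * A + A'`, and this is averaged over the columns `0 ≤ j ≤ s / δ`. -/
theorem mul_le_sum_boxColumns {δ s : ℝ} (hδ : 0 < δ) (hδs : δ ≤ s) {W P : ℤ → ℝ}
    (hW : ∀ k, 0 ≤ W k) (hP : ∀ k, 0 ≤ P k)
    (h : ∀ i : ℕ, δ * (i + 1) ≤ s → W i ≤ W (i + 1) + δ * (P i + W i + W (i + 1))) :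
    s * W 0 ≤ (1 + 4 * s) * (δ * ∑ k ∈ boxColumns δ s, W k + δ * ∑ k ∈ boxColumns δ s, P k) := by
  have hs : 0 < s := hδ.trans_le hδs
  set A := δ * ∑ k ∈ boxColumns δ s, W k with hA
  set A' := δ * ∑ k ∈ boxColumns δ s, P k with hA'
  have hA0 : 0 ≤ A := mul_nonneg hδ.le (Finset.sum_nonneg fun k _ => hW k)
  have hA0' : 0 ≤ A' := mul_nonneg hδ.le (Finset.sum_nonneg fun k _ => hP k)
  -- The last column reached is `c + j - 1`, so the admissible range is `δ (c + j) ≤ s + δ`. Only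
  -- the shifts `c = 0` and `c = 1` are used.
  have hsum : ∀ (f : ℤ → ℝ), (∀ k, 0 ≤ f k) → ∀ (c j : ℕ), δ * (c + j) ≤ s + δ →
      ∑ i ∈ Finset.range j, f (i + c) ≤ ∑ k ∈ boxColumns δ s, f k := by
    intro f hf c j hj
    rw [← Finset.sum_image (s := Finset.range j) (g := fun i : ℕ => (i + c : ℤ)) (f := f)
      (fun a _ b _ hab => by simpa using hab)]
    refine Finset.sum_le_sum_of_subset_of_nonneg (fun k hk => ?_) fun k _ _ => hf k
    obtain ⟨i, hi, rfl⟩ := Finset.mem_image.1 hk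
    rw [mem_boxColumns hδ]
    have hi' : (i : ℝ) + 1 ≤ j := by exact_mod_cast Finset.mem_range.1 hi
    push_cast
    rw [abs_of_nonneg (by positivity)]
    nlinarith
  have hiter : ∀ j : ℕ, δ * j ≤ s →
      W 0 ≤ W j + δ * ∑ i ∈ Finset.range j, (P i + W i + W (i + 1)) := by
    intro j
    induction j with
    | zero => simp
    | succ j ih =>
      intro hj
      push_cast at hj
      have := ih (by nlinarith)
      have := h j hj
      rw [Finset.sum_range_succ, mul_add]
      push_cast
      linarith
  have hstep : ∀ j : ℕ, δ * j ≤ s → W 0 ≤ W j + (2 * A + A') := by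
    intro j hj
    refine (hiter j hj).trans ?_
    have e0 := hsum W hW 0 j (by push_cast; linarith)
    have e1 := hsum W hW 1 j (by push_cast; linarith)
    have e2 := hsum P hP 0 j (by push_cast; linarith)
    simp only [Nat.cast_zero, add_zero, Nat.cast_one] at e0 e1 e2
    rw [Finset.sum_add_distrib, Finset.sum_add_distrib, mul_add, mul_add]
    have := mul_le_mul_of_nonneg_left e0 hδ.le
    have := mul_le_mul_of_nonneg_left e1 hδ.le
    have := mul_le_mul_of_nonneg_left e2 hδ.le
    linarith
  set N := ⌊s / δ⌋₊ with hN
  have hNs : δ * N ≤ s := by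
    rw [mul_comm, ← le_div_iff₀ hδ]; exact Nat.floor_le (by positivity)
  have hNs' : s ≤ δ * (N + 1) := by
    rw [mul_comm, ← div_le_iff₀ hδ]; exact (Nat.lt_floor_add_one _).le
  have hav : ∑ j ∈ Finset.range (N + 1), W 0 ≤
      ∑ j ∈ Finset.range (N + 1), (W j + (2 * A + A')) :=
    Finset.sum_le_sum fun j hj => hstep j <| by
      have : (j : ℝ) ≤ N := by exact_mod_cast Nat.lt_succ_iff.1 (Finset.mem_range.1 hj)
      nlinarith
  rw [Finset.sum_add_distrib, Finset.sum_const, Finset.sum_const, Finset.card_range,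
    nsmul_eq_mul, nsmul_eq_mul] at hav
  push_cast at hav
  have e0 := hsum W hW 0 (N + 1) (by push_cast; linarith)
  simp only [Nat.cast_zero, add_zero] at e0
  calc s * W 0 ≤ δ * (N + 1) * W 0 := mul_le_mul_of_nonneg_right hNs' (hW 0)
    _ = δ * ((N + 1) * W 0) := by ring
    _ ≤ δ * (∑ k ∈ boxColumns δ s, W k + (N + 1) * (2 * A + A')) := by gcongr; linarith
    _ = A + (δ * N + δ) * (2 * A + A') := by rw [hA]; ring
    _ ≤ A + (s + s) * (2 * A + A') := by gcongr
    _ ≤ _ := by nlinarith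

/-- With `a`, `b` the values on adjacent columns and `d` their difference quotient, `a² - b² = -δ d
(a + b) ≤ δ (d² + a² + b²)`; integrating in `y` gives the one-step hypothesis of
`mul_le_sum_boxColumns`. -/
theorem mul_integral_sq_le_boxEnergy {δ s : ℝ} (hδ : 0 < δ) (hδs : δ ≤ s) {v : ℤ → ℝ → ℝ}
    (hv : ∀ k : ℤ, |δ * k| ≤ s → ContinuousOn (v k) (Icc (-s) s)) :
    s * ∫ y in -s..s, v 0 y ^ 2 ≤
      (1 + 4 * s) * (boxEnergy δ s v + boxEnergy δ s (forwardDiff δ v)) := by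
  have hs : 0 < s := hδ.trans_le hδs
  refine mul_le_sum_boxColumns hδ hδs (W := fun k => ∫ y in -s..s, v k y ^ 2)
    (P := fun k => ∫ y in -s..s, forwardDiff δ v k y ^ 2)
    (fun k => intervalIntegral.integral_nonneg (by linarith) fun _ _ => sq_nonneg _)
    (fun k => intervalIntegral.integral_nonneg (by linarith) fun _ _ => sq_nonneg _)
    fun i hi => ?_
  have c0 := hv i (by push_cast; rw [abs_of_nonneg (by positivity)]; linarith)
  have c1 := hv (i + 1) (by push_cast; rwa [abs_of_nonneg (by positivity)])
  have cf : ContinuousOn (forwardDiff δ v i) (Icc (-s) s) := (c1.sub c0).div_const δ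
  have i0 := intervalIntegrable_of_continuousOn_box hs.le (c0.pow 2)
  have i1 := intervalIntegrable_of_continuousOn_box hs.le (c1.pow 2)
  have i2 := intervalIntegrable_of_continuousOn_box hs.le (cf.pow 2)
  simp only [Pi.pow_def] at i0 i1 i2
  rw [← intervalIntegral.integral_add i2 i0, ← intervalIntegral.integral_add (i2.add i0) i1,
    ← intervalIntegral.integral_const_mul,
    ← intervalIntegral.integral_add i1 (((i2.add i0).add i1).const_mul δ)]
  refine intervalIntegral.integral_mono_on (by linarith) i0
    (i1.add (((i2.add i0).add i1).const_mul δ)) fun y _ => ?_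
  have hd : v (i + 1) y - v i y = δ * forwardDiff δ v i y := by
    unfold forwardDiff; field_simp
  set d := forwardDiff δ v i y
  set a := v i y
  have hb : v (i + 1) y = a + δ * d := by linarith
  set b := v (i + 1) y
  have : a ^ 2 - b ^ 2 = -(δ * (d * (a + b))) := by
    rw [show δ * (d * (a + b)) = (δ * d) * (a + b) by ring, show δ * d = b - a by linarith]; ring
  have h2 : -(d * (a + b)) ≤ d ^ 2 + a ^ 2 + b ^ 2 := by
    nlinarith [sq_nonneg (d + (a + b)), sq_nonneg (a - b), sq_nonneg d]
  nlinarith [mul_le_mul_of_nonneg_left h2 hδ.le]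

/-- Semi-discrete harmonic functions are bounded by their `L²` norm. -/
theorem exists_sq_le_boxEnergy {s : ℝ} (hs : 0 < s) :
    ∃ C, 0 ≤ C ∧ ∀ δ, 0 < δ → δ ≤ s / 8 → ∀ u, IsHarmonicOnBox δ s u →
      u 0 0 ^ 2 ≤ C * boxEnergy δ s u := by
  obtain ⟨C₁, hC₁, H₁⟩ := exists_boxEnergy_gradient_le (s' := 3 * s / 4) (s := s)
    (by linarith) (by linarith)
  obtain ⟨C₂, hC₂, H₂⟩ := exists_boxEnergy_gradient_le (s' := s / 2) (s := 3 * s / 4)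
    (by linarith) (by linarith)
  set r := s / 2 with hr
  have hr0 : 0 < r := by rw [hr]; linarith
  -- The two fractions come from the vertical and horizontal Sobolev inequalities. The terms `1`,
  -- `C₁`, `C₁`, `C₂ * C₁` bound the energies of `u`, of its two first derivatives and of the mixed
  -- derivative, the last by two applications of Caccioppoli.
  refine ⟨(1 + r) / r * ((1 + 4 * r) / r * (1 + C₁ + C₁ + C₂ * C₁)), by positivity,
    fun δ hδ hδs u hu => ?_⟩
  have hu1 : IsHarmonicOnBox δ (3 * s / 4) (columnDeriv u) := (hu.columnDeriv hδ).mono (by linarith)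
  have hu2 : IsHarmonicOnBox δ (3 * s / 4) (forwardDiff δ u) :=
    (hu.forwardDiff hδ).mono (by linarith)
  have hur := hu.mono (show r ≤ s by linarith)
  have hur1 := hu1.mono (show r ≤ 3 * s / 4 by linarith)
  have nn : ∀ {q : ℝ} (v : ℤ → ℝ → ℝ), 0 ≤ q → 0 ≤ boxEnergy δ q v :=
    fun v hq => boxEnergy_nonneg hδ hq v
  set E := boxEnergy δ s u
  have hE : 0 ≤ E := nn u hs.le
  have a1 := H₁ δ hδ (by linarith) u hu
  have a2 := H₂ δ hδ (by linarith) (columnDeriv u) hu1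
  have b1 : boxEnergy δ r u ≤ E := boxEnergy_mono hδ hr0.le (by linarith)
    fun k hk => hu.continuousOn hk
  have b2 : boxEnergy δ r (columnDeriv u) ≤ boxEnergy δ (3 * s / 4) (columnDeriv u) :=
    boxEnergy_mono hδ hr0.le (by linarith) fun k hk => hu1.continuousOn hk
  have b3 : boxEnergy δ r (forwardDiff δ u) ≤ boxEnergy δ (3 * s / 4) (forwardDiff δ u) :=
    boxEnergy_mono hδ hr0.le (by linarith) fun k hk => hu2.continuousOn hk
  have n1 := nn (columnDeriv u) (show 0 ≤ 3 * s / 4 by linarith)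
  have n2 := nn (forwardDiff δ u) (show 0 ≤ 3 * s / 4 by linarith)
  have n3 := nn (columnDeriv (columnDeriv u)) hr0.le
  have a3 : boxEnergy δ (3 * s / 4) (columnDeriv u) ≤ C₁ * E := by linarith
  have a4 : boxEnergy δ r (forwardDiff δ (columnDeriv u)) ≤ C₂ * (C₁ * E) := by
    have := mul_le_mul_of_nonneg_left a3 hC₂
    linarith
  have m1 := mul_sq_le_integral hr0 (f := u 0) (f' := columnDeriv u 0)
    (fun y hy => (hur 0 y (by simpa using hr0.le) hy).1.hasDerivAt)
    (hur.continuousOn_columnDeriv (by simpa using hr0.le))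
  have m2 := mul_integral_sq_le_boxEnergy hδ (by linarith : δ ≤ r) (v := u)
    fun k hk => hur.continuousOn hk
  have m3 := mul_integral_sq_le_boxEnergy hδ (by linarith : δ ≤ r) (v := columnDeriv u)
    fun k hk => hur1.continuousOn hk
  rw [div_mul_eq_mul_div, div_mul_eq_mul_div, le_div_iff₀ hr0, mul_comm _ r]
  refine m1.trans ?_
  rw [mul_assoc]
  refine mul_le_mul_of_nonneg_left ?_ (by linarith)
  rw [div_mul_eq_mul_div, div_mul_eq_mul_div, le_div_iff₀ hr0, mul_comm _ r, mul_add]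
  refine (add_le_add m2 m3).trans ?_
  rw [← mul_add, mul_assoc]
  refine mul_le_mul_of_nonneg_left ?_ (by linarith)
  nlinarith

/-- Semi-discrete harmonic functions and their first derivatives are bounded by the `L²` norm. -/
theorem exists_sq_gradient_le_boxEnergy {s : ℝ} (hs : 0 < s) :
    ∃ C, 0 ≤ C ∧ ∀ δ, 0 < δ → δ ≤ s / 16 → ∀ u, IsHarmonicOnBox δ s u →
      u 0 0 ^ 2 ≤ C * boxEnergy δ s u ∧ columnDeriv u 0 0 ^ 2 ≤ C * boxEnergy δ s u ∧
      forwardDiff δ u 0 0 ^ 2 ≤ C * boxEnergy δ s u := by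
  obtain ⟨C₁, hC₁, H₁⟩ := exists_boxEnergy_gradient_le (s' := s / 2) (s := s)
    (by linarith) (by linarith)
  -- Used on the harmonic first derivatives, whose energy on the half box is controlled by
  -- Caccioppoli.
  obtain ⟨C₂, hC₂, H₂⟩ := exists_sq_le_boxEnergy (s := s / 2) (by linarith)
  obtain ⟨C₃, hC₃, H₃⟩ := exists_sq_le_boxEnergy hs
  refine ⟨C₃ + C₂ * C₁, by positivity, fun δ hδ hδs u hu => ?_⟩
  have hE := boxEnergy_nonneg hδ hs.le u
  have a1 := H₁ δ hδ (by linarith) u hu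
  have n1 := boxEnergy_nonneg hδ (by linarith : 0 ≤ s / 2) (columnDeriv u)
  have n2 := boxEnergy_nonneg hδ (by linarith : 0 ≤ s / 2) (forwardDiff δ u)
  have a2 := H₂ δ hδ (by linarith) _ ((hu.columnDeriv hδ).mono (by linarith))
  have a3 := H₂ δ hδ (by linarith) _ ((hu.forwardDiff hδ).mono (by linarith))
  have a4 := H₃ δ hδ (by linarith) u hu
  have p1 := mul_nonneg hC₃ hE
  have p2 := mul_nonneg (mul_nonneg hC₂ hC₁) hE
  refine ⟨by linarith, ?_, ?_⟩
  · have := mul_le_mul_of_nonneg_left (show boxEnergy δ (s / 2) (columnDeriv u) ≤ _ by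
      linarith) hC₂ (b := boxEnergy δ (s / 2) (columnDeriv u)) (c := C₁ * boxEnergy δ s u)
    linarith
  · have := mul_le_mul_of_nonneg_left (show boxEnergy δ (s / 2) (forwardDiff δ u) ≤ _ by
      linarith) hC₂ (b := boxEnergy δ (s / 2) (forwardDiff δ u)) (c := C₁ * boxEnergy δ s u)
    linarith

/-! ### Compactness -/

/-- A version of the Arzelà–Ascoli theorem for sequences of functions that need not be continuous
but are asymptotically equicontinuous. -/
theorem exists_subseq_tendstoUniformlyOn {E : Type*} [NormedAddCommGroup E] [ProperSpace E]
    {X : Type*} [PseudoMetricSpace X] [SecondCountableTopology X]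
    {Ω : Set X} (hΩ : IsOpen Ω) (F : ℕ → X → E)
    (hb : ∀ x ∈ Ω, ∃ M : ℝ, ∀ᶠ n in atTop, ‖F n x‖ ≤ M)
    (he : ∀ x ∈ Ω, ∀ ε > 0, ∃ r > 0, ∀ᶠ n in atTop,
      ∀ z, dist z x < r → ‖F n z - F n x‖ < ε) :
    ∃ φ : ℕ → ℕ, StrictMono φ ∧ ∃ H : X → E, ContinuousOn H Ω ∧
      ∀ K ⊆ Ω, IsCompact K → TendstoUniformlyOn (fun n => F (φ n)) H atTop K := by
  obtain ⟨Q, hQc, hQd⟩ := TopologicalSpace.exists_countable_dense X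
  have hbd : ∀ q : Q, ∃ M : ℝ, (q : X) ∈ Ω → ∀ n, ‖F n q‖ ≤ M := by
    intro q
    by_cases hq : (q : X) ∈ Ω
    · obtain ⟨M, hM⟩ := hb q hq
      obtain ⟨B, hB⟩ := (show IsBoundedUnder (· ≤ ·) atTop fun n => ‖F n q‖ from
        ⟨M, eventually_map.2 hM⟩).bddAbove_range
      exact ⟨B, fun _ n => hB ⟨n, rfl⟩⟩
    · exact ⟨0, fun h => absurd h hq⟩
  choose M hM using hbd
  classical
  have : Countable Q := hQc.to_subtype
  -- A countable product of balls is sequentially compact, which replaces the diagonal extraction.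
  -- Values outside `Ω`, where no bound is available, are set to `0`.
  obtain ⟨a, -, φ, hφ, hlim⟩ := (isCompact_univ_pi fun q : Q =>
    isCompact_closedBall (0 : E) (max (M q) 0)).tendsto_subseq
    (x := fun n (q : Q) => if (q : X) ∈ Ω then F n q else 0) (fun n q _ => by
      by_cases hq : (q : X) ∈ Ω
      · simp [hq, hM q hq n]
      · simp [hq])
  rw [tendsto_pi_nhds] at hlim
  have hlim' : ∀ q : Q, (q : X) ∈ Ω → Tendsto (fun n => F (φ n) q) atTop (𝓝 (a q)) := by
    intro q hq
    simpa [hq] using hlim q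
  -- Five errors of `ε / 5`, along `F n z`, `F n x`, `F n q`, `F m q`, `F m x`, `F m z` with `q` in
  -- the dense set. The second estimate passes to the limit as continuity of `H`.
  have hcauchy : ∀ x ∈ Ω, ∀ ε > 0, ∃ r > 0, ∃ N, ∀ n ≥ N, ∀ m ≥ N, ∀ z, dist z x < r →
      ‖F (φ n) z - F (φ m) z‖ < ε ∧ ‖F (φ n) z - F (φ n) x‖ < ε := by
    intro x hx ε hε
    obtain ⟨r, hr, hr'⟩ := he x hx (ε / 5) (by positivity)
    obtain ⟨r', hr0, hr2⟩ := Metric.isOpen_iff.1 hΩ x hx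
    obtain ⟨q, hq, hqQ⟩ := hQd.exists_dist_lt x (lt_min hr hr0)
    rw [dist_comm] at hqQ
    have hqΩ : q ∈ Ω := hr2 (Metric.mem_ball.2 (hqQ.trans_le (min_le_right _ _)))
    obtain ⟨N₁, hN₁⟩ := eventually_atTop.1 (hφ.tendsto_atTop.eventually hr')
    obtain ⟨N₂, hN₂⟩ := Metric.cauchySeq_iff.1 (hlim' ⟨q, hq⟩ hqΩ).cauchySeq (ε / 5)
      (by positivity)
    refine ⟨r, hr, max N₁ N₂, fun n hn m hm z hz => ⟨?_, ?_⟩⟩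
    · have hq' : dist q x < r := hqQ.trans_le (min_le_left _ _)
      have e1 := hN₁ n (le_of_max_le_left hn) z hz
      have e2 := hN₁ n (le_of_max_le_left hn) q hq'
      have e3 := hN₁ m (le_of_max_le_left hm) z hz
      have e4 := hN₁ m (le_of_max_le_left hm) q hq'
      have e5 := hN₂ n (le_of_max_le_right hn) m (le_of_max_le_right hm)
      simp only [← dist_eq_norm] at e1 e2 e3 e4 ⊢
      have t1 := dist_triangle (F (φ n) z) (F (φ n) x) (F (φ m) z)
      have t2 := dist_triangle_left (F (φ n) x) (F (φ m) z) (F (φ n) q)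
      have t3 := dist_triangle (F (φ n) q) (F (φ m) q) (F (φ m) z)
      have t4 := dist_triangle_right (F (φ m) q) (F (φ m) z) (F (φ m) x)
      linarith
    · have := hN₁ n (le_of_max_le_left hn) z hz
      linarith
  have hex : ∀ x : X, ∃ y : E, x ∈ Ω → Tendsto (fun n => F (φ n) x) atTop (𝓝 y) := by
    intro x
    by_cases hx : x ∈ Ω
    · have : CauchySeq fun n => F (φ n) x := Metric.cauchySeq_iff.2 fun ε hε => by
        obtain ⟨r, hr, N, hN⟩ := hcauchy x hx ε hε
        exact ⟨N, fun n hn m hm => by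
          rw [dist_eq_norm]; exact (hN n hn m hm x (by simpa using hr)).1⟩
      obtain ⟨y, hy⟩ := cauchySeq_tendsto_of_complete this
      exact ⟨y, fun _ => hy⟩
    · exact ⟨0, fun h => absurd h hx⟩
  choose H hH using hex
  have hloc : TendstoLocallyUniformlyOn (fun n => F (φ n)) H atTop Ω := by
    rw [Metric.tendstoLocallyUniformlyOn_iff]
    intro ε hε x hx
    obtain ⟨r, hr, N, hN⟩ := hcauchy x hx (ε / 2) (by positivity)
    refine ⟨Metric.ball x r ∩ Ω, inter_mem (mem_nhdsWithin_of_mem_nhds (Metric.ball_mem_nhds x hr))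
      self_mem_nhdsWithin, eventually_atTop.2 ⟨N, fun n hn z hz => ?_⟩⟩
    rw [dist_comm]
    refine (le_of_tendsto (tendsto_const_nhds.dist (hH z hz.2))
      (eventually_atTop.2 ⟨N, fun m hm => ?_⟩)).trans_lt (half_lt_self hε)
    rw [dist_eq_norm]
    exact (hN n hn m hm z hz.1).1.le
  refine ⟨φ, hφ, H, ?_, fun K hK hKc =>
    (tendstoLocallyUniformlyOn_iff_tendstoUniformlyOn_of_compact hKc).1 (hloc.mono hK)⟩
  intro x hx
  rw [Metric.continuousWithinAt_iff]
  intro ε hε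
  obtain ⟨r, hr, N, hN⟩ := hcauchy x hx (ε / 2) (by positivity)
  refine ⟨r, hr, fun z hz hzr => ?_⟩
  refine (le_of_tendsto ((hH z hz).dist (hH x hx))
    (eventually_atTop.2 ⟨N, fun n hn => ?_⟩)).trans_lt (half_lt_self hε)
  rw [dist_eq_norm]
  exact (hN n hn n hn z hzr).2.le

/-! ### From plane domains to lattice boxes -/

/-- The closed square with centre `x` and side length `2 s`. -/
def closedSquare (x : ℂ) (s : ℝ) : Set ℂ := {z | |z.re - x.re| ≤ s ∧ |z.im - x.im| ≤ s}

theorem closedSquare_subset_closedBall (x : ℂ) (s : ℝ) :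
    closedSquare x s ⊆ Metric.closedBall x (2 * s) := fun z hz => by
  rw [Metric.mem_closedBall, dist_eq_norm]
  refine (Complex.norm_le_abs_re_add_abs_im _).trans ?_
  simp only [Complex.sub_re, Complex.sub_im]
  linarith [hz.1, hz.2]

section

variable {𝕜 : Type*} [RCLike 𝕜]

/-- The function `ℓ ∘ f` in the lattice coordinates centred at `δ k₀ + i y₀`. -/
noncomputable def recenter (δ : ℝ) (f : ℂ → 𝕜) (ℓ : 𝕜 →L[ℝ] ℝ) (k₀ : ℤ) (y₀ : ℝ) : ℤ → ℝ → ℝ :=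
  fun k y => ℓ (f ⟨δ * ((k₀ + k : ℤ) : ℝ), y₀ + y⟩)

theorem recenter_mem {δ s : ℝ} {x : ℂ} {k₀ k : ℤ} {y₀ y : ℝ}
    (h : (⟨δ * k₀, y₀⟩ : ℂ) ∈ closedSquare x s) (hk : |δ * k| ≤ s) (hy : |y| ≤ s) :
    (⟨δ * ((k₀ + k : ℤ) : ℝ), y₀ + y⟩ : ℂ) ∈ closedSquare x (2 * s) := by
  obtain ⟨h1, h2⟩ := h
  simp only [closedSquare, mem_ofPred_eq, abs_le] at *
  push_cast
  constructor <;> constructor <;> linarith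

/-- The radii `s`, `2 * s`, `3 * s` serve box centres, points of the boxes around them, and the
lattice neighbours of those points. -/
theorem mem_interiorTwo {δ s : ℝ} (hδ : 0 < δ) (hδs : δ ≤ s) {D : Set ℂ} {x : ℂ}
    (hD : closedSquare x (3 * s) ⊆ D) {k : ℤ} {y : ℝ}
    (h : (⟨δ * k, y⟩ : ℂ) ∈ closedSquare x (2 * s)) : (⟨δ * k, y⟩ : ℂ) ∈ interiorTwo δ D := by
  obtain ⟨h1, h2⟩ := h
  have hmem : ∀ c : ℝ, |c| ≤ δ → (⟨δ * k + c, y⟩ : ℂ) ∈ D := fun c hc => hD <| by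
    simp only [closedSquare, mem_ofPred_eq, abs_le] at *
    constructor <;> constructor <;> linarith
  have hadd : ∀ a c : ℝ, (⟨a, y⟩ : ℂ) + (c : ℂ) = ⟨a + c, y⟩ := fun a c =>
    Complex.ext (by simp) (by simp)
  have hsub : ∀ a c : ℝ, (⟨a, y⟩ : ℂ) - (c : ℂ) = ⟨a + -c, y⟩ := fun a c =>
    Complex.ext (by simp [sub_eq_add_neg]) (by simp)
  have hhalf : |δ / 2| ≤ δ := by rw [abs_of_pos (by linarith)]; linarith
  have hfull : |δ| ≤ δ := (abs_of_pos hδ).le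
  have h0 : (⟨δ * k, y⟩ : ℂ) ∈ primalVertices δ D := ⟨by simpa using hmem 0 (by simpa using hδ.le),
    k, rfl⟩
  refine ⟨h0, ⟨⟨?_, k, ?_⟩, ?_, ?_⟩, ⟨⟨?_, k - 1, ?_⟩, ?_, ?_⟩⟩
  · rw [hadd]; exact hmem _ hhalf
  · rw [hadd]; simp only; ring
  · rw [hadd, hadd, add_assoc, add_halves]; exact ⟨hmem _ hfull, k + 1, by push_cast; ring⟩
  · rwa [add_sub_cancel_right]
  · rw [hsub]; exact hmem _ (by rwa [abs_neg])
  · rw [hsub]; push_cast; ring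
  · rwa [sub_add_cancel]
  · rw [hsub, hsub, add_assoc, ← neg_add, add_halves]
    exact ⟨hmem _ (by rwa [abs_neg]), k - 1, by push_cast; ring⟩

theorem deriv_recenter {δ : ℝ} {f : ℂ → 𝕜} (ℓ : 𝕜 →L[ℝ] ℝ) {k₀ k : ℤ} {y₀ y : ℝ}
    (h : DifferentiableAt ℝ (column f (δ * ((k₀ + k : ℤ) : ℝ))) (y₀ + y)) :
    HasDerivAt (recenter δ f ℓ k₀ y₀ k) (ℓ (deriv (column f (δ * ((k₀ + k : ℤ) : ℝ))) (y₀ + y))) y :=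
  ℓ.hasFDerivAt.comp_hasDerivAt y (h.hasDerivAt.comp_const_add y₀ y)

/-- A continuous real-linear functional commutes with differentiation along columns and with
division by the real number `δ ^ 2`, so it turns the `𝕜`-valued equation into a real one. -/
theorem isHarmonicOnBox_recenter {δ s : ℝ} (hδ : 0 < δ) (hδs : δ ≤ s) {D : Set ℂ} {x : ℂ}
    (hD : closedSquare x (3 * s) ⊆ D) {f : ℂ → 𝕜} (hf : IsHarmonic δ D f) (ℓ : 𝕜 →L[ℝ] ℝ)
    {k₀ : ℤ} {y₀ : ℝ} (h : (⟨δ * k₀, y₀⟩ : ℂ) ∈ closedSquare x s) :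
    IsHarmonicOnBox δ s (recenter δ f ℓ k₀ y₀) := by
  intro k y hk hy
  have hp := recenter_mem h hk hy
  have hint := mem_interiorTwo hδ hδs hD hp
  obtain ⟨d1, d2⟩ := hf.1 _ hint.1
  simp only at d1 d2
  refine ⟨(deriv_recenter ℓ d1).differentiableAt, ?_⟩
  have hev : deriv (recenter δ f ℓ k₀ y₀ k) =ᶠ[𝓝 y]
      fun z => ℓ (deriv (column f (δ * ((k₀ + k : ℤ) : ℝ))) (y₀ + z)) := by
    filter_upwards [Metric.ball_mem_nhds y (hδ.trans_le hδs)] with z hz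
    have hz' : (⟨δ * ((k₀ + k : ℤ) : ℝ), y₀ + z⟩ : ℂ) ∈ D := hD <| by
      rw [Metric.mem_ball, Real.dist_eq, abs_lt] at hz
      obtain ⟨h1, h2⟩ := hp
      simp only [closedSquare, mem_ofPred_eq, abs_le] at *
      constructor <;> constructor <;> linarith
    exact (deriv_recenter ℓ (hf.1 _ ⟨hz', _, rfl⟩).1).deriv
  refine HasDerivAt.congr_of_eventuallyEq ?_ hev
  refine (ℓ.hasFDerivAt.comp_hasDerivAt y (d2.hasDerivAt.comp_const_add y₀ y)).congr_deriv ?_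
  have hL := hf.2 _ hint
  rw [laplacian] at hL
  have e1 : (⟨δ * ((k₀ + k : ℤ) : ℝ), y₀ + y⟩ : ℂ) + (δ : ℂ) =
      ⟨δ * ((k₀ + (k + 1) : ℤ) : ℝ), y₀ + y⟩ := by
    apply Complex.ext <;> simp; ring
  have e2 : (⟨δ * ((k₀ + k : ℤ) : ℝ), y₀ + y⟩ : ℂ) - (δ : ℂ) =
      ⟨δ * ((k₀ + (k - 1) : ℤ) : ℝ), y₀ + y⟩ := by
    apply Complex.ext <;> simp; ring
  rw [e1, e2] at hL
  have hL' := eq_neg_of_add_eq_zero_right hL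
  simp only at hL'
  rw [hL', map_neg]
  have hdiv : ∀ w : 𝕜, ℓ (w / (δ : 𝕜) ^ 2) = ℓ w / δ ^ 2 := fun w => by
    have : w / (δ : 𝕜) ^ 2 = ((δ ^ 2)⁻¹ : ℝ) • w := by
      rw [RCLike.real_smul_eq_coe_mul]; push_cast; rw [div_eq_inv_mul]
    rw [this, map_smul, smul_eq_mul, div_eq_inv_mul]
  have htwo : ∀ w : 𝕜, ℓ (2 * w) = 2 * ℓ w := fun w => by rw [two_mul, map_add, two_mul]
  rw [hdiv, map_sub, map_add, htwo]
  rfl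

/-- The real and imaginary parts suffice to bound the norm. -/
theorem norm_le_of_forall_abs_le {w : 𝕜} {L : ℝ} (h : ∀ ℓ : 𝕜 →L[ℝ] ℝ, ‖ℓ‖ ≤ 1 → |ℓ w| ≤ L) :
    ‖w‖ ≤ 2 * L := by
  have h1 := h RCLike.reCLM (ContinuousLinearMap.opNorm_le_bound _ zero_le_one fun z => by
    simpa using RCLike.abs_re_le_norm z)
  have h2 := h RCLike.imCLM (ContinuousLinearMap.opNorm_le_bound _ zero_le_one fun z => by
    simpa using RCLike.abs_im_le_norm z)
  simp only [RCLike.reCLM_apply, RCLike.imCLM_apply] at h1 h2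
  have h3 : ‖w‖ ≤ |RCLike.re w| + |RCLike.im w| := by
    conv_lhs => rw [← RCLike.re_add_im w]
    refine (norm_add_le _ _).trans (add_le_add (RCLike.norm_ofReal _).le ?_)
    rw [norm_mul, RCLike.norm_ofReal]
    exact mul_le_of_le_one_right (abs_nonneg _) (by rw [RCLike.norm_I]; split_ifs <;> simp)
  linarith

/-- Local bounds for a semi-discrete harmonic function and its first derivatives. -/
theorem exists_forall_norm_le {s : ℝ} (hs : 0 < s) (M : ℝ) :
    ∃ L, 0 ≤ L ∧ ∀ δ, 0 < δ → δ ≤ s / 16 → ∀ (D : Set ℂ) (x : ℂ) (f : ℂ → 𝕜),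
      closedSquare x (3 * s) ⊆ D → IsHarmonic δ D f →
      (∀ ℓ : 𝕜 →L[ℝ] ℝ, ‖ℓ‖ ≤ 1 → ∀ (k : ℤ) (y : ℝ), (⟨δ * k, y⟩ : ℂ) ∈ closedSquare x s →
        boxEnergy δ s (recenter δ f ℓ k y) ≤ M) →
      ∀ (k : ℤ) (y : ℝ), (⟨δ * k, y⟩ : ℂ) ∈ closedSquare x s →
        ‖f ⟨δ * k, y⟩‖ ≤ L ∧ ‖deriv (column f (δ * k)) y‖ ≤ L ∧
        ‖f ⟨δ * ((k + 1 : ℤ) : ℝ), y⟩ - f ⟨δ * k, y⟩‖ ≤ L * δ := by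
  obtain ⟨C, hC, H⟩ := exists_sq_gradient_le_boxEnergy hs
  refine ⟨2 * Real.sqrt (C * M), by positivity, fun δ hδ hδs D x f hD hf hE k y hky => ?_⟩
  have key : ∀ ℓ : 𝕜 →L[ℝ] ℝ, ‖ℓ‖ ≤ 1 → |ℓ (f ⟨δ * k, y⟩)| ≤ Real.sqrt (C * M) ∧
      |ℓ (deriv (column f (δ * k)) y)| ≤ Real.sqrt (C * M) ∧
      |ℓ (f ⟨δ * ((k + 1 : ℤ) : ℝ), y⟩ - f ⟨δ * k, y⟩)| ≤ Real.sqrt (C * M) * δ := by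
    intro ℓ hℓ
    have hu := isHarmonicOnBox_recenter hδ (by linarith) hD hf ℓ hky
    obtain ⟨h1, h2, h3⟩ := H δ hδ hδs _ hu
    have hM := mul_le_mul_of_nonneg_left (hE ℓ hℓ k y hky) hC
    have hint := mem_interiorTwo hδ (by linarith) hD (y := y) (k := k)
      ⟨hky.1.trans (by linarith), hky.2.trans (by linarith)⟩
    have hd := deriv_recenter ℓ (k₀ := k) (k := 0) (y₀ := y) (y := 0) (f := f) (δ := δ)
      (by simpa using (hf.1 _ hint.1).1)
    simp only [add_zero] at hd
    rw [columnDeriv, hd.deriv] at h2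
    have e1 : forwardDiff δ (recenter δ f ℓ k y) 0 0 =
        ℓ (f ⟨δ * ((k + 1 : ℤ) : ℝ), y⟩ - f ⟨δ * k, y⟩) / δ := by
      simp [forwardDiff, recenter]
    have e2 : recenter δ f ℓ k y 0 0 = ℓ (f ⟨δ * k, y⟩) := by simp [recenter]
    rw [e1] at h3
    rw [e2] at h1
    refine ⟨Real.abs_le_sqrt (h1.trans hM), Real.abs_le_sqrt (h2.trans hM), ?_⟩
    have := Real.abs_le_sqrt (h3.trans hM)
    rwa [abs_div, abs_of_pos hδ, div_le_iff₀ hδ] at this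
  refine ⟨norm_le_of_forall_abs_le fun ℓ hℓ => (key ℓ hℓ).1,
    norm_le_of_forall_abs_le fun ℓ hℓ => (key ℓ hℓ).2.1, ?_⟩
  rw [mul_assoc]
  exact norm_le_of_forall_abs_le fun ℓ hℓ => (key ℓ hℓ).2.2

/-! ### Lipschitz estimates and convergence -/

/-- Telescoping over adjacent columns; the intermediate vertices remain in the square by convexity.
-/
theorem norm_sub_le_of_horizontal {δ s L : ℝ} (hδ : 0 < δ) {x : ℂ} {f : ℂ → 𝕜}
    (hL : ∀ (k : ℤ) (y : ℝ), (⟨δ * k, y⟩ : ℂ) ∈ closedSquare x s →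
        ‖f ⟨δ * ((k + 1 : ℤ) : ℝ), y⟩ - f ⟨δ * k, y⟩‖ ≤ L * δ) {k l : ℤ} {y : ℝ}
    (hk : (⟨δ * k, y⟩ : ℂ) ∈ closedSquare x s) (hl : (⟨δ * l, y⟩ : ℂ) ∈ closedSquare x s) :
    ‖f ⟨δ * k, y⟩ - f ⟨δ * l, y⟩‖ ≤ L * |δ * k - δ * l| := by
  wlog hkl : l ≤ k generalizing k l
  · rw [norm_sub_rev, abs_sub_comm]
    exact this hl hk (by omega)
  obtain ⟨n, rfl⟩ := Int.le.dest hkl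
  clear hkl
  induction n with
  | zero => simp
  | succ n ih =>
    have hmem : (⟨δ * ((l + n : ℤ) : ℝ), y⟩ : ℂ) ∈ closedSquare x s := by
      simp only [closedSquare, mem_ofPred_eq, abs_le] at *
      push_cast at *
      have : 0 ≤ δ * (n : ℝ) := by positivity
      refine ⟨⟨by nlinarith, by nlinarith⟩, hk.2⟩
    have h1 := ih hmem
    have h2 := hL _ _ hmem
    have e : l + ((n + 1 : ℕ) : ℤ) = l + n + 1 := by push_cast; ring
    rw [e]
    calc _ ≤ _ := norm_sub_le_norm_sub_add_norm_sub _ (f ⟨δ * ((l + n : ℤ) : ℝ), y⟩) _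
      _ ≤ _ := add_le_add h2 h1
      _ = _ := by
        push_cast
        rw [show δ * ((l : ℝ) + n + 1) - δ * l = δ * (n + 1) by ring,
          show δ * ((l : ℝ) + n) - δ * l = δ * n by ring, abs_of_nonneg (by positivity),
          abs_of_nonneg (by positivity)]
        ring

theorem norm_sub_le_of_vertical {δ s L : ℝ} {x : ℂ} {f : ℂ → 𝕜} {k : ℤ}
    (hd : ∀ y : ℝ, (⟨δ * k, y⟩ : ℂ) ∈ closedSquare x s →
      DifferentiableAt ℝ (column f (δ * k)) y)
    (hL : ∀ y : ℝ, (⟨δ * k, y⟩ : ℂ) ∈ closedSquare x s → ‖deriv (column f (δ * k)) y‖ ≤ L)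
    {y z : ℝ} (hy : (⟨δ * k, y⟩ : ℂ) ∈ closedSquare x s)
    (hz : (⟨δ * k, z⟩ : ℂ) ∈ closedSquare x s) :
    ‖f ⟨δ * k, y⟩ - f ⟨δ * k, z⟩‖ ≤ L * |y - z| := by
  have hmem : ∀ t ∈ Icc (x.im - s) (x.im + s), (⟨δ * k, t⟩ : ℂ) ∈ closedSquare x s :=
    fun t ht => ⟨hy.1, abs_le.2 ⟨by simp only; linarith [ht.1], by simp only; linarith [ht.2]⟩⟩
  have hmem' : ∀ t, (⟨δ * k, t⟩ : ℂ) ∈ closedSquare x s → t ∈ Icc (x.im - s) (x.im + s) :=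
    fun t ht => by
      have := abs_le.1 ht.2
      simp only at this
      exact ⟨by linarith, by linarith⟩
  exact Convex.norm_image_sub_le_of_norm_deriv_le (f := column f (δ * k))
    (fun t ht => hd t (hmem t ht)) (fun t ht => hL t (hmem t ht)) (convex_Icc _ _)
    (hmem' z hz) (hmem' y hy)

/-- The vertex of the lattice `δℤ × ℝ` immediately to the left of `z`. -/
noncomputable def latticeFloor (δ : ℝ) (z : ℂ) : ℂ := ⟨δ * ⌊z.re / δ⌋, z.im⟩

theorem abs_latticeFloor_re_sub_le {δ : ℝ} (hδ : 0 < δ) (z : ℂ) :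
    |δ * ⌊z.re / δ⌋ - z.re| ≤ δ := by
  have h1 := (le_div_iff₀ hδ).1 (Int.floor_le (z.re / δ))
  have h2 := (div_lt_iff₀ hδ).1 (Int.lt_floor_add_one (z.re / δ))
  rw [abs_le]
  constructor <;> nlinarith

theorem latticeFloor_eq {δ : ℝ} (hδ : 0 < δ) {p : ℂ} (hp : p ∈ primalLattice δ) :
    latticeFloor δ p = p := by
  obtain ⟨k, hk⟩ := hp
  refine Complex.ext ?_ rfl
  simp only [latticeFloor]
  rw [hk, mul_div_cancel_left₀ _ hδ.ne', Int.floor_intCast]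

/-- The energy of `h δ` is bounded near each point of `Ω`, uniformly in `δ`. -/
def LocallyBoundedEnergy (Ω : Set ℂ) (h : ℝ → ℂ → 𝕜) : Prop :=
  ∀ x ∈ Ω, ∃ s > 0, closedSquare x (3 * s) ⊆ Ω ∧ ∃ M, ∀ᶠ δ in 𝓝[>] (0 : ℝ),
    ∀ ℓ : 𝕜 →L[ℝ] ℝ, ‖ℓ‖ ≤ 1 → ∀ (k : ℤ) (y : ℝ), (⟨δ * k, y⟩ : ℂ) ∈ closedSquare x s →
      boxEnergy δ s (recenter δ (h δ) ℓ k y) ≤ M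

theorem isCompact_closedSquare (x : ℂ) (s : ℝ) : IsCompact (closedSquare x s) := by
  refine (isCompact_closedBall x (2 * s)).of_isClosed_subset ?_ (closedSquare_subset_closedBall x s)
  have h1 : Continuous fun z : ℂ => |z.re - x.re| := by fun_prop
  have h2 : Continuous fun z : ℂ => |z.im - x.im| := by fun_prop
  exact (isClosed_le h1 continuous_const).inter (isClosed_le h2 continuous_const)

/-- Local Lipschitz estimates at the scale of the lattice, uniform in the mesh size. -/
theorem LocallyBoundedEnergy.eventually_norm_sub_le {Ω : Set ℂ} {δ₀ : ℝ} (hδ₀ : 0 < δ₀)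
    {D : ℝ → Set ℂ} (hD : IsSemiDiscretization Ω δ₀ D) {h : ℝ → ℂ → 𝕜}
    (hh : ∀ δ, 0 < δ → δ < δ₀ → IsHarmonic δ (D δ) (h δ)) (hE : LocallyBoundedEnergy Ω h)
    {x : ℂ} (hx : x ∈ Ω) :
    ∃ s > 0, ∃ L, 0 ≤ L ∧ ∀ᶠ δ in 𝓝[>] (0 : ℝ), ‖h δ (latticeFloor δ x)‖ ≤ L ∧
      ∀ z, dist z x < s →
        ‖h δ (latticeFloor δ z) - h δ (latticeFloor δ x)‖ ≤ L * (2 * dist z x + 2 * δ) := by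
  obtain ⟨s, hs, hsΩ, M, hM⟩ := hE x hx
  obtain ⟨L, hL0, hL⟩ := exists_forall_norm_le (𝕜 := 𝕜) hs M
  -- Rounding moves the abscissa by at most `δ < s / 16`, so points within `s / 2` of `x` round into
  -- the square of half-side `s`.
  refine ⟨s / 2, by positivity, L, hL0, ?_⟩
  have hpos : ∀ᶠ δ in 𝓝[>] (0 : ℝ), 0 < δ := self_mem_nhdsWithin
  have hlt : ∀ c > (0 : ℝ), ∀ᶠ δ in 𝓝[>] (0 : ℝ), δ < c := fun c hc =>
    mem_nhdsWithin_of_mem_nhds (Iio_mem_nhds hc)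
  filter_upwards [hM, hpos, hlt δ₀ hδ₀, hlt (s / 16) (by positivity),
    hD.exhausts _ hsΩ (isCompact_closedSquare _ _)] with δ hMδ hδ hδδ₀ hδs hDδ
  have H := hL δ hδ hδs.le (D δ) x (h δ) hDδ (hh δ hδ hδδ₀) hMδ
  have hfl : ∀ z, dist z x < s / 2 → ∀ w, dist w x < s / 2 →
      (⟨δ * ⌊z.re / δ⌋, w.im⟩ : ℂ) ∈ closedSquare x s := by
    intro z hz w hw
    have h1 := (Complex.abs_re_le_norm (z - x)).trans_lt (by rwa [← dist_eq_norm])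
    have h2 := (Complex.abs_im_le_norm (w - x)).trans_lt (by rwa [← dist_eq_norm])
    have h3 := abs_latticeFloor_re_sub_le hδ z
    rw [Complex.sub_re] at h1
    rw [Complex.sub_im] at h2
    refine ⟨?_, by simp only; linarith⟩
    have := abs_sub_le (δ * ⌊z.re / δ⌋ : ℝ) z.re x.re
    simp only
    linarith
  have hxx : dist x x < s / 2 := by rw [dist_self]; positivity
  refine ⟨(H _ _ (hfl x hxx x hxx)).1, fun z hz => ?_⟩
  -- The path goes vertically in the column of `z` to the height of `x`, then horizontally to the
  -- column of `x`. Rounding both abscissas accounts for the `2 * δ`.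
  have a1 := norm_sub_le_of_vertical (s := s) (x := x) (f := h δ) (k := ⌊z.re / δ⌋)
    (fun y hy => ((hh δ hδ hδδ₀).1 ⟨_, y⟩ ⟨hDδ ⟨hy.1.trans (by linarith),
      hy.2.trans (by linarith)⟩, _, rfl⟩).1) (fun y hy => (H _ y hy).2.1)
    (hfl z hz z hz) (hfl z hz x hxx)
  have a2 := norm_sub_le_of_horizontal hδ (fun k y hk => (H k y hk).2.2) (hfl z hz x hxx)
    (hfl x hxx x hxx)
  have b1 := Complex.abs_im_le_norm (z - x)
  have b2 := Complex.abs_re_le_norm (z - x)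
  rw [← dist_eq_norm, Complex.sub_im] at b1
  rw [← dist_eq_norm, Complex.sub_re] at b2
  have b3 := abs_latticeFloor_re_sub_le hδ z
  have b4 := abs_latticeFloor_re_sub_le hδ x
  have b5 : |δ * ⌊z.re / δ⌋ - δ * ⌊x.re / δ⌋| ≤ dist z x + 2 * δ := by
    rw [abs_le] at *
    constructor <;> linarith
  calc _ ≤ _ := norm_sub_le_norm_sub_add_norm_sub _ (h δ ⟨δ * ⌊z.re / δ⌋, x.im⟩) _
    _ ≤ L * |z.im - x.im| + L * |δ * ⌊z.re / δ⌋ - δ * ⌊x.re / δ⌋| := add_le_add a1 a2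
    _ ≤ L * dist z x + L * (dist z x + 2 * δ) := by gcongr
    _ = _ := by ring

/-- The compactness lemma is applied to the step functions `z ↦ h δ (latticeFloor δ z)`. Rounding
fixes lattice points, so their uniform convergence restricts to the vertices. -/
theorem LocallyBoundedEnergy.precompactOnCompacts {Ω : Set ℂ} (hΩ : IsOpen Ω) {δ₀ : ℝ}
    (hδ₀ : 0 < δ₀) {D : ℝ → Set ℂ} (hD : IsSemiDiscretization Ω δ₀ D) {h : ℝ → ℂ → 𝕜}
    (hh : ∀ δ, 0 < δ → δ < δ₀ → IsHarmonic δ (D δ) (h δ)) (hE : LocallyBoundedEnergy Ω h) :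
    PrecompactOnCompacts Ω δ₀ D h := by
  intro δ hδ hδ0
  have hδ' : Tendsto δ atTop (𝓝[>] 0) :=
    tendsto_nhdsWithin_iff.2 ⟨hδ0, Eventually.of_forall fun n => (hδ n).1⟩
  obtain ⟨φ, hφ, H, hH, hHK⟩ := exists_subseq_tendstoUniformlyOn hΩ
    (fun n z => h (δ n) (latticeFloor (δ n) z))
    (fun x hx => by
      obtain ⟨s, -, L, -, hL⟩ := hE.eventually_norm_sub_le hδ₀ hD hh hx
      exact ⟨L, (hδ'.eventually hL).mono fun n hn => hn.1⟩)
    (fun x hx ε hε => by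
      obtain ⟨s, hs, L, hL0, hL⟩ := hE.eventually_norm_sub_le hδ₀ hD hh hx
      have hc : 0 < ε / (4 * (L + 1)) := by positivity
      refine ⟨min s (ε / (4 * (L + 1))), lt_min hs hc, ?_⟩
      filter_upwards [hδ'.eventually hL, hδ0.eventually_lt_const hc] with n hn hnc z hz
      refine (hn.2 z (hz.trans_le (min_le_left _ _))).trans_lt ?_
      have hz' := hz.trans_le (min_le_right s _)
      have hsum : 2 * dist z x + 2 * δ n < ε / (L + 1) := by
        have : ε / (L + 1) = 4 * (ε / (4 * (L + 1))) := by field_simp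
        linarith
      calc _ ≤ L * (ε / (L + 1)) := mul_le_mul_of_nonneg_left hsum.le hL0
        _ < (L + 1) * (ε / (L + 1)) := by gcongr; linarith
        _ = ε := by field_simp)
  refine ⟨φ, hφ, H, hH, fun K hK hKc ε hε => ?_⟩
  filter_upwards [Metric.tendstoUniformlyOn_iff.1 (hHK K hK hKc) ε hε] with n hn p hp
  have := hn p hp.1
  rwa [latticeFloor_eq (hδ _).1 hp.2.2, dist_comm, dist_eq_norm] at this

/-! ### Both assumptions bound the local energies -/

theorem exists_closedSquare_subset {Ω : Set ℂ} (hΩ : IsOpen Ω) {x : ℂ} (hx : x ∈ Ω) :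
    ∃ s > 0, closedSquare x (3 * s) ⊆ Ω := by
  obtain ⟨r, hr, hrΩ⟩ := Metric.nhds_basis_closedBall.mem_iff.1 (hΩ.mem_nhds hx)
  refine ⟨r / 6, by positivity, (closedSquare_subset_closedBall _ _).trans ?_⟩
  rwa [show 2 * (3 * (r / 6)) = r by ring]

theorem abs_apply_le_norm {ℓ : 𝕜 →L[ℝ] ℝ} (hℓ : ‖ℓ‖ ≤ 1) (w : 𝕜) : |ℓ w| ≤ ‖w‖ :=
  (ℓ.le_opNorm w).trans (mul_le_of_le_one_left (norm_nonneg _) hℓ)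

theorem mul_card_boxColumns_le {δ s : ℝ} (hδ : 0 < δ) (hδs : δ ≤ s) :
    δ * (boxColumns δ s).card ≤ 3 * s := by
  have h1 : ((boxColumns δ s).card : ℝ) ≤ s / δ - -s / δ + 1 := by
    rw [boxColumns, Int.card_Icc]
    have a := Int.floor_le (s / δ)
    have b := Int.le_ceil (-s / δ)
    have hc : ⌈-s / δ⌉ ≤ ⌊s / δ⌋ + 1 := by
      have : -s / δ ≤ 0 := div_nonpos_of_nonpos_of_nonneg (by linarith) hδ.le
      have h2 : (0 : ℤ) ≤ ⌊s / δ⌋ := Int.floor_nonneg.2 (div_nonneg (by linarith) hδ.le)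
      have h3 : ⌈-s / δ⌉ ≤ 0 := Int.ceil_le.2 (by simpa using this)
      omega
    have : (((⌊s / δ⌋ + 1 - ⌈-s / δ⌉).toNat : ℤ) : ℝ) = ⌊s / δ⌋ + 1 - ⌈-s / δ⌉ := by
      rw [Int.toNat_of_nonneg (by omega)]; push_cast; ring
    rw [← Int.cast_natCast, this]
    linarith
  calc _ ≤ δ * (s / δ - -s / δ + 1) := mul_le_mul_of_nonneg_left h1 hδ.le
    _ = 2 * s + δ := by field_simp; ring
    _ ≤ _ := by linarith

theorem UniformlyBoundedOnCompacts.locallyBoundedEnergy {Ω : Set ℂ} (hΩ : IsOpen Ω) {δ₀ : ℝ}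
    (hδ₀ : 0 < δ₀) {D : ℝ → Set ℂ} (hD : IsSemiDiscretization Ω δ₀ D) {h : ℝ → ℂ → 𝕜}
    (hb : UniformlyBoundedOnCompacts Ω δ₀ D h) : LocallyBoundedEnergy Ω h := by
  intro x hx
  obtain ⟨s, hs, hsΩ⟩ := exists_closedSquare_subset hΩ hx
  obtain ⟨M, hM⟩ := hb _ hsΩ (isCompact_closedSquare _ _)
  refine ⟨s, hs, hsΩ, 3 * s * (M ^ 2 * (2 * s)), ?_⟩
  have hpos : ∀ᶠ δ in 𝓝[>] (0 : ℝ), 0 < δ := self_mem_nhdsWithin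
  have hlt : ∀ c > (0 : ℝ), ∀ᶠ δ in 𝓝[>] (0 : ℝ), δ < c := fun c hc =>
    mem_nhdsWithin_of_mem_nhds (Iio_mem_nhds hc)
  filter_upwards [hpos, hlt δ₀ hδ₀, hlt s hs,
    hD.exhausts _ hsΩ (isCompact_closedSquare _ _)] with δ hδ hδδ₀ hδs hDδ ℓ hℓ k₀ y₀ hky
  have hterm : ∀ k ∈ boxColumns δ s, ∫ y in -s..s, recenter δ (h δ) ℓ k₀ y₀ k y ^ 2
      ≤ M ^ 2 * (2 * s) := by
    intro k hk
    refine (le_abs_self _).trans ?_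
    have := intervalIntegral.norm_integral_le_of_norm_le_const (a := -s) (b := s) (C := M ^ 2)
      (f := fun y => recenter δ (h δ) ℓ k₀ y₀ k y ^ 2) fun y hy => by
        rw [uIoc_of_le (by linarith)] at hy
        have hmem := recenter_mem hky ((mem_boxColumns hδ).1 hk)
          (abs_le.2 ⟨hy.1.le, hy.2⟩)
        have hmem' : (⟨δ * ((k₀ + k : ℤ) : ℝ), y₀ + y⟩ : ℂ) ∈ closedSquare x (3 * s) :=
          ⟨hmem.1.trans (by linarith), hmem.2.trans (by linarith)⟩
        have := (abs_apply_le_norm hℓ _).trans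
          (hM δ hδ hδδ₀ _ ⟨hmem', hDδ hmem', _, rfl⟩)
        rw [norm_pow]
        exact pow_le_pow_left₀ (norm_nonneg _) this 2
    rwa [sub_neg_eq_add, ← two_mul, abs_of_pos (by positivity : 0 < 2 * s)] at this
  calc boxEnergy δ s (recenter δ (h δ) ℓ k₀ y₀)
      ≤ δ * ∑ k ∈ boxColumns δ s, M ^ 2 * (2 * s) :=
        mul_le_mul_of_nonneg_left (Finset.sum_le_sum hterm) hδ.le
    _ = δ * (boxColumns δ s).card * (M ^ 2 * (2 * s)) := by
        rw [Finset.sum_const, nsmul_eq_mul]; ring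
    _ ≤ _ := mul_le_mul_of_nonneg_right (mul_card_boxColumns_le hδ hδs.le) (by positivity)

/-- The recentred box lies in `S` and `ℓ` does not increase norms. The bound of an integral by the
lower integral of its norm requires no measurability of `f`, and the finite column sum is dominated
by the full series after a shift by `k₀`. -/
theorem ofReal_boxEnergy_recenter_le {δ s : ℝ} (hδ : 0 < δ) (hs : 0 < s) {S : Set ℂ} {x : ℂ}
    (hS : closedSquare x (2 * s) ⊆ S) (f : ℂ → 𝕜) {ℓ : 𝕜 →L[ℝ] ℝ} (hℓ : ‖ℓ‖ ≤ 1)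
    {k₀ : ℤ} {y₀ : ℝ} (hky : (⟨δ * k₀, y₀⟩ : ℂ) ∈ closedSquare x s) :
    ENNReal.ofReal (boxEnergy δ s (recenter δ f ℓ k₀ y₀)) ≤
      integralOn δ S fun p => ‖f p‖ₑ ^ 2 := by
  have hterm : ∀ k ∈ boxColumns δ s,
      ENNReal.ofReal (∫ y in -s..s, recenter δ f ℓ k₀ y₀ k y ^ 2) ≤
        ∫⁻ y in {y : ℝ | (⟨δ * ((k₀ + k : ℤ) : ℝ), y⟩ : ℂ) ∈ S},
          ‖f ⟨δ * ((k₀ + k : ℤ) : ℝ), y⟩‖ₑ ^ 2 := by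
    intro k hk
    rw [intervalIntegral.integral_of_le (by linarith),
      ← Real.enorm_of_nonneg (integral_nonneg fun _ => sq_nonneg _)]
    refine (enorm_integral_le_lintegral_enorm _).trans ?_
    calc _ ≤ ∫⁻ y in Ioc (-s) s, ‖f ⟨δ * ((k₀ + k : ℤ) : ℝ), y₀ + y⟩‖ₑ ^ 2 := by
          refine lintegral_mono fun y => ?_
          rw [enorm_pow]
          gcongr
          exact enorm_le_iff_norm_le.2 (abs_apply_le_norm hℓ _)
      _ = ∫⁻ y in (fun y => y₀ + y) ⁻¹' Ioc (y₀ - s) (y₀ + s),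
            ‖f ⟨δ * ((k₀ + k : ℤ) : ℝ), y₀ + y⟩‖ₑ ^ 2 := by
          congr 2
          ext y
          simp only [mem_Ioc, mem_preimage]
          constructor <;> rintro ⟨h1, h2⟩ <;> constructor <;> linarith
      _ = ∫⁻ y in Ioc (y₀ - s) (y₀ + s), ‖f ⟨δ * ((k₀ + k : ℤ) : ℝ), y⟩‖ₑ ^ 2 :=
          (measurePreserving_add_left volume y₀).setLIntegral_comp_preimage_emb
            (measurableEmbedding_addLeft y₀) (fun y => ‖f ⟨δ * ((k₀ + k : ℤ) : ℝ), y⟩‖ₑ ^ 2) _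
      _ ≤ _ := lintegral_mono_set fun y hy => hS <| by
          have := recenter_mem hky ((mem_boxColumns hδ).1 hk) (y := y - y₀)
            (abs_le.2 ⟨by linarith [hy.1], by linarith [hy.2]⟩)
          rwa [add_sub_cancel] at this
  rw [boxEnergy, ENNReal.ofReal_mul hδ.le, integralOn]
  gcongr
  rw [ENNReal.ofReal_sum_of_nonneg fun k _ =>
    intervalIntegral.integral_nonneg (by linarith) fun _ _ => sq_nonneg _]
  refine (Finset.sum_le_sum hterm).trans ?_
  refine le_trans (ENNReal.sum_le_tsum _) ?_
  exact ((Equiv.addLeft k₀).tsum_eq fun k : ℤ => ∫⁻ y in {y : ℝ | (⟨δ * k, y⟩ : ℂ) ∈ S},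
    ‖f ⟨δ * k, y⟩‖ₑ ^ 2).le

theorem UniformlySquareIntegrableOnCompacts.locallyBoundedEnergy {Ω : Set ℂ} (hΩ : IsOpen Ω)
    {δ₀ : ℝ} (hδ₀ : 0 < δ₀) {D : ℝ → Set ℂ} (hD : IsSemiDiscretization Ω δ₀ D) {h : ℝ → ℂ → 𝕜}
    (hb : UniformlySquareIntegrableOnCompacts Ω δ₀ D h) : LocallyBoundedEnergy Ω h := by
  intro x hx
  obtain ⟨s, hs, hsΩ⟩ := exists_closedSquare_subset hΩ hx
  obtain ⟨M, hM0, hM⟩ := hb _ hsΩ (isCompact_closedSquare _ _)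
  refine ⟨s, hs, hsΩ, M, ?_⟩
  have hpos : ∀ᶠ δ in 𝓝[>] (0 : ℝ), 0 < δ := self_mem_nhdsWithin
  filter_upwards [hpos, mem_nhdsWithin_of_mem_nhds (Iio_mem_nhds hδ₀),
    hD.exhausts _ hsΩ (isCompact_closedSquare _ _)] with δ hδ hδδ₀ hDδ ℓ hℓ k₀ y₀ hky
  rw [← ENNReal.ofReal_le_ofReal_iff hM0.le]
  refine (ofReal_boxEnergy_recenter_le hδ hs (fun z hz => ?_) (h δ) hℓ hky).trans (hM δ hδ hδδ₀)
  have hz' : z ∈ closedSquare x (3 * s) := ⟨hz.1.trans (by linarith), hz.2.trans (by linarith)⟩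
  exact ⟨hz', hDδ hz'⟩

end

end SemiDiscrete

theorem theorem3p17 {𝕜 : Type*} [RCLike 𝕜]
    (Ω : Set ℂ) (hΩ : SemiDiscrete.IsPlaneDomain Ω)
    (δ₀ : ℝ) (hδ₀ : 0 < δ₀)
    (D : ℝ → Set ℂ) (hD : SemiDiscrete.IsSemiDiscretization Ω δ₀ D)
    (h : ℝ → ℂ → 𝕜)
    (hh : ∀ δ, 0 < δ → δ < δ₀ → SemiDiscrete.IsHarmonic δ (D δ) (h δ)) :
    (SemiDiscrete.UniformlyBoundedOnCompacts Ω δ₀ D h →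
      SemiDiscrete.PrecompactOnCompacts Ω δ₀ D h) ∧
    (SemiDiscrete.UniformlySquareIntegrableOnCompacts Ω δ₀ D h →
      SemiDiscrete.PrecompactOnCompacts Ω δ₀ D h) :=
  ⟨fun hb => (hb.locallyBoundedEnergy hΩ.isOpen hδ₀ hD).precompactOnCompacts hΩ.isOpen hδ₀ hD hh,
    fun hb => (hb.locallyBoundedEnergy hΩ.isOpen hδ₀ hD).precompactOnCompacts hΩ.isOpen hδ₀ hD hh⟩
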